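/- Let $(X_i)_{i\ge 1}$ be a (not necessarily stationary) sequence of centered real-valued random variables on a probability space, each of them almost surely bounded. Write $S_n=X_1+\dots+X_n$ (with $S_0=0$), $V_n=\mathrm{Var}(S_n)$ and $K_n=\max_{1\le i\le n}\|X_i\|_\infty$. For two $\sigma$-algebras $\mathcal U,\mathcal V$ let $\rho(\mathcal U,\mathcal V)=\sup\{|\mathrm{corr}(Y,Z)| : Y\in\mathbb L^2(\mathcal U),\ Z\in\mathbb L^2(\mathcal V)\}$ (the correlation being $0$ if $Y$ or $Z$ is almost surely constant), and for $k\ge 0$ put $$\rho(k)=\sup_{j\ge 1}\ \sup_{v>u\ge j+k}\rho\big(\sigma(X_i,\,1\le i\le j),\,\sigma(X_u,X_v)\big).$$ Assume that $\rho(k)\to 0$ as $k\to\infty$, that $$\sum_{k\ge 1}k\,\rho(k)<\infty,$$ and that, for every $n\ge 1$, $$C_n:=\max_{1\le \ell\le n}\frac{\sum_{i=\ell}^n\mathbb E(X_i^2)}{\mathbb E\big((S_n-S_{\ell-1})^2\big)}<\infty,$$ where $x/0=\infty$ for $x>0$ and $0/0=0$. Let $W_1(\mu,\nu)=\inf_P\int|x-y|\,P(dx,dy)$,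 the infimum being over all probability laws $P$ on $\mathbb R^2$ with marginals $\mu$ and $\nu$; let $P_{S_n}$ be the law of $S_n$ and $G_{a}$ the normal law $\mathcal N(0,a)$, with $G_0=\delta_0$. Then there is a constant $C>0$, not depending on $n$ (it may depend on the law of the sequence $(X_i)_{i\ge 1}$), such that for every integer $n\ge 1$ $$W_1(P_{S_n},G_{V_n})\le C\,K_n\big(1+C_n\log(1+C_nV_n)\big).$$ -/

import Mathlib

open MeasureTheory ProbabilityTheory Filter Topology
open scoped ENNReal NNReal

namespace RhoMixingCLT

noncomputable section

/-- The Wasserstein distance of order one between two laws on `ℝ`: the infimum of `∫ |x - y| dP`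
over all laws `P` on `ℝ × ℝ` with marginals `ν₁` and `ν₂`. -/
def W₁ (ν₁ ν₂ : Measure ℝ) : ℝ≥0∞ :=
  ⨅ (P : Measure (ℝ × ℝ)) (_ : P.map Prod.fst = ν₁ ∧ P.map Prod.snd = ν₂),
    ∫⁻ z, ENNReal.ofReal |z.1 - z.2| ∂P

/-- The correlation `cov (f, g) / (Var f · Var g) ^ (1 / 2)` of two square integrable random
variables. It is `0` if one of them is almost surely constant. -/
def corr {Ω : Type*} [MeasurableSpace Ω] (f g : Ω → ℝ) (μ : Measure Ω) : ℝ :=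
  cov[f, g; μ] / (√(Var[f; μ]) * √(Var[g; μ]))

/-- The maximal correlation coefficient between two σ-algebras: the supremum of `|corr (f, g)|`
over the square integrable `f` and `g` measurable with respect to `U` and `V`. -/
def maxCorr {Ω : Type*} (U V : MeasurableSpace Ω) [MeasurableSpace Ω] (μ : Measure Ω) : ℝ≥0∞ :=
  ⨆ (f : Ω → ℝ) (g : Ω → ℝ) (_ : Measurable[U] f ∧ MemLp f 2 μ)
    (_ : Measurable[V] g ∧ MemLp g 2 μ), ENNReal.ofReal |corr f g μ|

/-- The σ-algebra generated by the `X t` with `t ∈ A`. -/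
abbrev sigmaGen {Ω : Type*} (X : ℕ → Ω → ℝ) (A : Set ℕ) : MeasurableSpace Ω :=
  ⨆ t ∈ A, MeasurableSpace.comap (X t) inferInstance

/-- The ρ-mixing coefficient `ρ(k)` of the sequence `X 1, X 2, …`: past up to time `j` against
two future instants `u < v` with `j + k ≤ u`. -/
def rho {Ω : Type*} [MeasurableSpace Ω] (X : ℕ → Ω → ℝ) (μ : Measure Ω) (k : ℕ) : ℝ≥0∞ :=
  ⨆ (j : ℕ) (_ : 1 ≤ j) (u : ℕ) (v : ℕ) (_ : j + k ≤ u ∧ u < v),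
    maxCorr (sigmaGen X (Set.Icc 1 j)) (sigmaGen X {u, v}) μ

/-- The partial sum `S n = X 1 + ⋯ + X n`. -/
def S {Ω : Type*} (X : ℕ → Ω → ℝ) (n : ℕ) (ω : Ω) : ℝ :=
  ∑ i ∈ Finset.Icc 1 n, X i ω

/-- The constant `C_n = max_{1 ≤ ℓ ≤ n} (∑_{i = ℓ}^n E (X i ^ 2)) / E ((S n - S (ℓ - 1)) ^ 2)` as an
extended nonnegative real. A quotient `x / 0` is `∞` for `x > 0`, and `0 / 0` is `0`. -/
def varRatio {Ω : Type*} [MeasurableSpace Ω] (X : ℕ → Ω → ℝ) (μ : Measure Ω) (n : ℕ) : ℝ≥0∞ :=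
  (Finset.Icc 1 n).sup fun ℓ =>
    ENNReal.ofReal (∑ i ∈ Finset.Icc ℓ n, ∫ ω, X i ω ^ 2 ∂μ) /
      ENNReal.ofReal (∫ ω, (S X n ω - S X (ℓ - 1) ω) ^ 2 ∂μ)

/-- `K_n = max_{1 ≤ i ≤ n} ‖X i‖_∞`, with the essential supremum norm. -/
def maxSupNorm {Ω : Type*} [MeasurableSpace Ω] (X : ℕ → Ω → ℝ) (μ : Measure Ω) (n : ℕ) : ℝ≥0∞ :=
  (Finset.Icc 1 n).sup fun i => eLpNorm (X i) ∞ μ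

end

end RhoMixingCLT

/-! The quantile coupling gives W₁ ≤ ∫ |F₁ - F₂|, so it suffices to bound ∫ f dν₁ - ∫ f dν₂ for
bounded f whose derivative is smooth, compactly supported and bounded by 1 (`W₁_le_of_smooth_dual`).

For such f a Lindeberg interpolation is used. Put Z_l = X_{l+1}, S_l = Z_0 + ⋯ + Z_{l-1}, K = K_n,
t_l = K² + E(Z_l + ⋯ + Z_{n-1})² and u(t,x) = E f(x + √t N) with N standard normal. Then E u(t_l,
S_l) runs from u(K² + V_n, 0) to E u(K², S_n), and the extra variance K² costs O(K) at each end.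
Since ∂_t u = ∂_xx u / 2, while the third and fourth space derivatives are O(1/t) and O(1/t^{3/2}),
the bounds |Z_l| ≤ K ≤ √t make the Taylor remainder of one step O(K E Z_l² / w_l), where w_l is a
lower bound for t_l and t_{l+1}.

The main terms cancel only after summation over l. On one side, t_l - t_{l+1} = E Z_l² + 2 ∑_{i>l} E
Z_l Z_i. On the other, telescoping E u'(t_l, S_l) Z_l over the past m < l produces E u''(t_m, S_m)
Z_m Z_l, plus remainders controlled by mixing. Exchanging sums leaves the covariances of u''(t_l,
S_l) with Z_l Z_i, i ≥ l. Telescoping u'' over m < l in turn, each increment decorrelates from Z_l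
Z_i at the rate of the larger of the gaps l - m and i - l (`CorrelationDecay.abs_cov_mul_le`). As 2k
+ 1 pairs of gaps have maximum k, summability of k ρ(k) is what is needed. The total is O(K ∑ E Z_l²
/ w_l) (`CorrelationDecay.abs_integral_sub_le`).

By definition of C_n, w_l = K² + C_n⁻¹ ∑_{i>l} E Z_i² is admissible, and the sum is then O(C_n log(1
+ C_n V_n / K²)) (`sum_div_tail_le_log`). Finally K_n is nondecreasing in n, so its positive values
are bounded below and K² is absorbed in the constant. -/

namespace RhoMixingCLT

/-! ### Wasserstein distance: quantile coupling and smooth duality. -/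

section Wasserstein

open Set

/-- The quantile function of a law on `ℝ`, set to `0` outside the open unit interval. -/
noncomputable def quantile (ν : Measure ℝ) (u : ℝ) : ℝ :=
  (Ioo (0 : ℝ) 1).indicator (fun u => sInf {x | u ≤ cdf ν x}) u

/-- Right continuity of the distribution function makes the infimum attained. This Galois connection
converts events about quantiles into inequalities for `cdf`. -/
lemma quantile_le_iff (ν : Measure ℝ) {u : ℝ} (hu : u ∈ Ioo (0 : ℝ) 1) (x : ℝ) :
    quantile ν u ≤ x ↔ u ≤ cdf ν x := by
  rw [quantile, indicator_of_mem hu]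
  set A := {x | u ≤ cdf ν x} with hA
  have hne : A.Nonempty := by
    obtain ⟨y, hy⟩ := ((tendsto_cdf_atTop ν).eventually_const_le hu.2).exists
    exact ⟨y, hy⟩
  have hbdd : BddBelow A := by
    obtain ⟨a, ha⟩ := ((tendsto_cdf_atBot ν).eventually_lt_const hu.1).exists
    refine ⟨a, fun y hy => ?_⟩
    by_contra! hlt
    exact absurd (hy.trans (monotone_cdf ν hlt.le)) (not_le.2 ha)
  refine ⟨fun h => ?_, fun h => csInf_le hbdd h⟩
  refine le_trans ?_ (monotone_cdf ν h)
  have hright : Tendsto (cdf ν) (𝓝[>] sInf A) (𝓝 (cdf ν (sInf A))) :=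
    ((cdf ν).right_continuous (sInf A)).mono Ioi_subset_Ici_self
  refine ge_of_tendsto hright ?_
  filter_upwards [self_mem_nhdsWithin] with y hy
  obtain ⟨a, haA, hay⟩ := exists_lt_of_csInf_lt hne hy
  exact le_trans haA (monotone_cdf ν hay.le)

lemma measurable_quantile (ν : Measure ℝ) : Measurable (quantile ν) := by
  refine measurable_of_Iic fun x => ?_
  have : quantile ν ⁻¹' Iic x =
      (Ioo (0 : ℝ) 1 ∩ Iic (cdf ν x)) ∪ ((Ioo (0 : ℝ) 1)ᶜ ∩ {_u | 0 ≤ x}) := by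
    ext u
    by_cases hu : u ∈ Ioo (0 : ℝ) 1
    · simp only [mem_preimage, mem_Iic, quantile_le_iff ν hu, mem_union, mem_inter_iff, hu,
        mem_compl_iff, true_and, not_true_eq_false, false_and, or_false]
    · simp only [mem_preimage, mem_Iic, quantile, indicator_of_notMem hu, mem_union,
        mem_inter_iff, hu, mem_compl_iff, false_and, not_false_eq_true, true_and, false_or,
        mem_ofPred_eq]
  rw [this]
  exact (measurableSet_Ioo.inter measurableSet_Iic).union
    (measurableSet_Ioo.compl.inter (MeasurableSet.const _))

lemma map_quantile (ν : Measure ℝ) [IsProbabilityMeasure ν] :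
    (volume.restrict (Ioo (0 : ℝ) 1)).map (quantile ν) = ν := by
  have : IsFiniteMeasure ((volume.restrict (Ioo (0 : ℝ) 1)).map (quantile ν)) :=
    Measure.isFiniteMeasure_map _ _
  refine Measure.ext_of_Iic _ _ fun x => ?_
  rw [Measure.map_apply (measurable_quantile ν) measurableSet_Iic,
    Measure.restrict_apply (measurable_quantile ν measurableSet_Iic), ← ofReal_cdf ν x]
  have hset : quantile ν ⁻¹' Iic x ∩ Ioo 0 1 = Ioo 0 1 ∩ Iic (cdf ν x) := by
    ext u
    constructor
    · rintro ⟨h1, h2⟩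
      exact ⟨h2, (quantile_le_iff ν h2 x).1 h1⟩
    · rintro ⟨h1, h2⟩
      exact ⟨(quantile_le_iff ν h1 x).2 h2, h1⟩
  rw [hset]
  apply le_antisymm
  · calc volume (Ioo 0 1 ∩ Iic (cdf ν x)) ≤ volume (Ioc 0 (cdf ν x)) :=
          measure_mono fun u hu => ⟨hu.1.1, hu.2⟩
      _ = _ := by rw [Real.volume_Ioc, sub_zero]
  · calc ENNReal.ofReal (cdf ν x) = volume (Ioo 0 (cdf ν x)) := by
          rw [Real.volume_Ioo, sub_zero]
      _ ≤ volume (Ioo 0 1 ∩ Iic (cdf ν x)) := measure_mono fun u hu =>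
          ⟨⟨hu.1, hu.2.trans_le (cdf_le_one ν x)⟩, hu.2.le⟩

/-- Both laws are realized as quantiles of one uniform variable u. The distance |a - b| is the
length of the set of levels x separating a from b. After Tonelli, the u whose two quantiles are
separated by x lie between the two values of the distribution functions at x. -/
lemma W₁_le_lintegral_cdf (ν₁ ν₂ : Measure ℝ) [IsProbabilityMeasure ν₁]
    [IsProbabilityMeasure ν₂] :
    W₁ ν₁ ν₂ ≤ ∫⁻ x, ENNReal.ofReal |cdf ν₁ x - cdf ν₂ x| := by
  set U : Measure ℝ := volume.restrict (Ioo (0 : ℝ) 1) with hU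
  have hm1 := measurable_quantile ν₁
  have hm2 := measurable_quantile ν₂
  refine (iInf₂_le (U.map fun u => (quantile ν₁ u, quantile ν₂ u)) ⟨?_, ?_⟩).trans ?_
  rotate_left
  · rw [Measure.map_map measurable_fst (hm1.prodMk hm2)]
    exact map_quantile ν₁
  · rw [Measure.map_map measurable_snd (hm1.prodMk hm2)]
    exact map_quantile ν₂
  have hmeas : MeasurableSet {p : ℝ × ℝ | ¬(quantile ν₁ p.1 ≤ p.2 ↔ quantile ν₂ p.1 ≤ p.2)} :=
    ((measurableSet_le (hm1.comp measurable_fst) measurable_snd).iff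
      (measurableSet_le (hm2.comp measurable_fst) measurable_snd)).compl
  have habs : ∀ a b : ℝ, ENNReal.ofReal |a - b| = volume {x : ℝ | ¬(a ≤ x ↔ b ≤ x)} := by
    intro a b
    have : {x : ℝ | ¬(a ≤ x ↔ b ≤ x)} = Ico (min a b) (max a b) := by
      ext x
      simp only [mem_ofPred_eq, mem_Ico, min_le_iff, lt_max_iff]
      grind
    rw [this, Real.volume_Ico, max_sub_min_eq_abs, abs_sub_comm]
  rw [lintegral_map (by fun_prop) (hm1.prodMk hm2)]
  calc ∫⁻ u, ENNReal.ofReal |quantile ν₁ u - quantile ν₂ u| ∂U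
      = ∫⁻ u, (∫⁻ x, {p : ℝ × ℝ | ¬(quantile ν₁ p.1 ≤ p.2 ↔ quantile ν₂ p.1 ≤ p.2)}.indicator
          (fun _ => (1 : ℝ≥0∞)) (u, x)) ∂U := by
        refine lintegral_congr fun u => ?_
        rw [habs]
        exact (lintegral_indicator_one (measurable_prodMk_left hmeas)).symm
    _ = ∫⁻ x, ∫⁻ u, {p : ℝ × ℝ | ¬(quantile ν₁ p.1 ≤ p.2 ↔ quantile ν₂ p.1 ≤ p.2)}.indicator
          (fun _ => (1 : ℝ≥0∞)) (u, x) ∂U :=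
        lintegral_lintegral_swap (measurable_const.indicator hmeas).aemeasurable
    _ ≤ _ := by
        refine lintegral_mono fun x => ?_
        have : (fun u => {p : ℝ × ℝ | ¬(quantile ν₁ p.1 ≤ p.2 ↔ quantile ν₂ p.1 ≤ p.2)}.indicator
            (fun _ => (1 : ℝ≥0∞)) (u, x)) =
            {u | ¬(quantile ν₁ u ≤ x ↔ quantile ν₂ u ≤ x)}.indicator 1 := rfl
        have hmx : MeasurableSet {u | ¬(quantile ν₁ u ≤ x ↔ quantile ν₂ u ≤ x)} :=
          measurable_prodMk_right hmeas
        rw [this, lintegral_indicator_one hmx, Measure.restrict_apply hmx]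
        calc _ ≤ volume (Ioc (min (cdf ν₁ x) (cdf ν₂ x)) (max (cdf ν₁ x) (cdf ν₂ x))) := by
              refine measure_mono ?_
              rintro u ⟨h1, h2⟩
              simp only [mem_ofPred_eq, quantile_le_iff _ h2] at h1
              simp only [mem_Ioc, min_lt_iff, le_max_iff]
              grind
          _ = _ := by rw [Real.volume_Ioc, max_sub_min_eq_abs, abs_sub_comm]

/-- The optimal test function is the sign of H cut off to [-R, R]. Mollification makes it smooth,
keeps the bound 1 and converges almost everywhere, so dominated convergence applies; then R tends to
infinity. -/
lemma lintegral_abs_le_of_smooth_dual {H : ℝ → ℝ} (hH : Measurable H) (hH1 : ∀ x, |H x| ≤ 1)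
    {B : ℝ} (hB : ∀ s : ℝ → ℝ, ContDiff ℝ ((⊤ : ℕ∞) : WithTop ℕ∞) s → HasCompactSupport s →
      (∀ x, |s x| ≤ 1) → ∫ x, s x * H x ≤ B) :
    ∫⁻ x, ENNReal.ofReal |H x| ≤ ENNReal.ofReal B := by
  have key : ∀ R : ℕ, ∫⁻ x in Icc (-(R : ℝ)) R, ENNReal.ofReal |H x| ≤ ENNReal.ofReal B := by
    intro R
    set g : ℝ → ℝ := (Icc (-(R : ℝ)) R).indicator (fun x => SignType.sign (H x)) with hg
    have hsgn : Measurable (fun x => ((SignType.sign (H x) : SignType) : ℝ)) := by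
      have : (fun x => ((SignType.sign (H x) : SignType) : ℝ)) =
          fun x => if 0 < H x then (1 : ℝ) else if H x < 0 then -1 else 0 := by
        ext x
        simp only [sign_apply]
        split_ifs <;> simp
      rw [this]
      exact Measurable.ite (measurableSet_lt measurable_const hH) measurable_const
        (Measurable.ite (measurableSet_lt hH measurable_const) measurable_const measurable_const)
    have hgm : Measurable g := hsgn.indicator measurableSet_Icc
    have hg1 : ∀ x, |g x| ≤ 1 := by
      intro x
      by_cases hx : x ∈ Icc (-(R : ℝ)) R
      · rw [hg, indicator_of_mem hx]
        rcases SignType.trichotomy (SignType.sign (H x)) with h | h | h <;> simp [h]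
      · rw [hg, indicator_of_notMem hx]; simp
    have hg0 : ∀ x, (R : ℝ) < |x| → g x = 0 := by
      intro x hx
      refine indicator_of_notMem (fun h => ?_) _
      exact absurd (abs_le.2 h) (not_le.2 hx)
    have hgsupp : HasCompactSupport g :=
      HasCompactSupport.intro isCompact_Icc fun x hx => indicator_of_notMem hx _
    have hgint : Integrable g := by
      have : Integrable ((Icc (-(R : ℝ)) R).indicator (fun _ => (1 : ℝ))) := by
        rw [integrable_indicator_iff measurableSet_Icc]
        exact integrableOn_const (by simp) (by simp)
      refine this.mono hgm.aestronglyMeasurable (ae_of_all _ fun x => ?_)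
      by_cases hx : x ∈ Icc (-(R : ℝ)) R
      · rw [indicator_of_mem hx]
        simpa using hg1 x
      · rw [hg, indicator_of_notMem hx, indicator_of_notMem hx]
    -- The outer radius is twice the inner one, a bounded ratio, as the Lebesgue differentiation
    -- argument for `hlim` requires. It is also at most 2, so all the mollified functions vanish
    -- outside [-(R+2), R+2].
    let φ : ℕ → ContDiffBump (0 : ℝ) := fun k =>
      ⟨1 / (k + 1), 2 / (k + 1), by positivity, by gcongr; norm_num⟩
    have hφout : Tendsto (fun k => (φ k).rOut) atTop (𝓝 0) := by
      have := (tendsto_one_div_add_atTop_nhds_zero_nat (𝕜 := ℝ)).const_mul 2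
      simp only [mul_zero] at this
      refine this.congr fun k => ?_
      change 2 * (1 / ((k : ℝ) + 1)) = 2 / (k + 1)
      ring
    let s : ℕ → ℝ → ℝ := fun k =>
      convolution ((φ k).normed volume) g (ContinuousLinearMap.lsmul ℝ ℝ) volume
    have hsx : ∀ k x, s k x = ∫ t, (φ k).normed volume t * g (x - t) := fun k x => rfl
    have hs1 : ∀ k x, |s k x| ≤ 1 := by
      intro k x
      rw [hsx, ← Real.norm_eq_abs]
      calc ‖∫ t, (φ k).normed volume t * g (x - t)‖ ≤ ∫ t, (φ k).normed volume t := by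
            refine norm_integral_le_of_norm_le (φ k).integrable_normed (ae_of_all _ fun t => ?_)
            rw [norm_mul, Real.norm_of_nonneg ((φ k).nonneg_normed t)]
            exact mul_le_of_le_one_right ((φ k).nonneg_normed t) (hg1 _)
        _ = 1 := (φ k).integral_normed
    have hs0 : ∀ k x, (R : ℝ) + 2 < |x| → s k x = 0 := by
      intro k x hx
      rw [hsx]
      refine integral_eq_zero_of_ae (ae_of_all _ fun t => ?_)
      by_cases ht : |t| ≤ 2
      · have : g (x - t) = 0 := hg0 _ (by
          have := abs_sub_abs_le_abs_sub x t
          linarith)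
        simp [this]
      · have : (φ k).normed volume t = 0 := by
          have hsup := (φ k).support_normed_eq (μ := volume)
          by_contra hne
          have hmem : t ∈ Function.support ((φ k).normed volume) := hne
          rw [hsup, Metric.mem_ball, Real.dist_eq, sub_zero] at hmem
          have : (φ k).rOut ≤ 2 := by
            change 2 / ((k : ℝ) + 1) ≤ 2
            exact div_le_self (by norm_num) (by linarith [k.cast_nonneg (α := ℝ)])
          linarith
        simp [this]
    have hscd : ∀ k, ContDiff ℝ ((⊤ : ℕ∞) : WithTop ℕ∞) (s k) := fun k =>
      (φ k).hasCompactSupport_normed.contDiff_convolution_left _ (φ k).contDiff_normed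
        hgint.locallyIntegrable
    have hscs : ∀ k, HasCompactSupport (s k) := fun k =>
      HasCompactSupport.intro (isCompact_Icc (a := -((R : ℝ) + 2)) (b := R + 2)) fun x hx =>
        hs0 k x (by
          by_contra! h
          exact hx (abs_le.1 h))
    have hlim : ∀ᵐ x, Tendsto (fun k => s k x) atTop (𝓝 (g x)) :=
      ContDiffBump.ae_convolution_tendsto_right_of_locallyIntegrable (K := 2) hφout
        (Eventually.of_forall fun k => by
          change 2 / ((k : ℝ) + 1) ≤ 2 * (1 / (k + 1))
          exact le_of_eq (by ring)) hgint.locallyIntegrable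
    have hdct : Tendsto (fun k => ∫ x, s k x * H x) atTop (𝓝 (∫ x, g x * H x)) := by
      refine tendsto_integral_of_dominated_convergence
        ((Icc (-((R : ℝ) + 2)) (R + 2)).indicator (fun _ => (1 : ℝ)))
        (fun k => ((hscd k).continuous.measurable.mul hH).aestronglyMeasurable) ?_ ?_ ?_
      · rw [integrable_indicator_iff measurableSet_Icc]
        exact integrableOn_const (by simp) (by simp)
      · refine fun k => ae_of_all _ fun x => ?_
        by_cases hx : x ∈ Icc (-((R : ℝ) + 2)) (R + 2)
        · rw [indicator_of_mem hx, norm_mul]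
          exact mul_le_one₀ (hs1 k x) (norm_nonneg _) (hH1 x)
        · rw [indicator_of_notMem hx, hs0 k x (by
            by_contra! h
            exact hx (abs_le.1 h))]
          simp
      · filter_upwards [hlim] with x hx using hx.mul_const _
    have hle : ∫ x, g x * H x ≤ B := le_of_tendsto' hdct fun k => hB _ (hscd k) (hscs k) (hs1 k)
    have hgH : (fun x => g x * H x) = (Icc (-(R : ℝ)) R).indicator (fun x => |H x|) := by
      ext x
      by_cases hx : x ∈ Icc (-(R : ℝ)) R
      · rw [hg, indicator_of_mem hx, indicator_of_mem hx, sign_mul_self]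
      · rw [hg, indicator_of_notMem hx, indicator_of_notMem hx, zero_mul]
    rw [hgH, integral_indicator measurableSet_Icc] at hle
    have hInt : IntegrableOn (fun x => |H x|) (Icc (-(R : ℝ)) R) := by
      refine Measure.integrableOn_of_bounded (M := 1) (by simp) ?_ (ae_of_all _ fun x => ?_)
      · exact hH.abs.aestronglyMeasurable
      · simpa using hH1 x
    rw [← ofReal_integral_eq_lintegral_ofReal hInt (ae_of_all _ fun x => abs_nonneg _)]
    exact ENNReal.ofReal_le_ofReal hle
  have hcover : AECover (volume : Measure ℝ) atTop (fun R : ℕ => Icc (-(R : ℝ)) R) :=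
    aecover_Icc (tendsto_neg_atTop_atBot.comp tendsto_natCast_atTop_atTop)
      tendsto_natCast_atTop_atTop
  exact le_of_tendsto' (hcover.lintegral_tendsto_of_countably_generated
    hH.abs.ennreal_ofReal.aemeasurable) key

/-- A law integrates the primitive of a compactly supported function `s` to
`∫ s (1 - cdf)`. -/
lemma integral_primitive_eq (ν : Measure ℝ) [IsProbabilityMeasure ν] {s : ℝ → ℝ}
    (hs : Integrable s) :
    ∫ x, (∫ u in Iio x, s u) ∂ν = ∫ u, s u * (1 - cdf ν u) := by
  have hm : MeasurableSet {p : ℝ × ℝ | p.2 < p.1} := measurableSet_lt measurable_snd measurable_fst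
  have h1 : ∀ x, ∫ u in Iio x, s u =
      ∫ u, {p : ℝ × ℝ | p.2 < p.1}.indicator (fun p => s p.2) (x, u) := by
    intro x
    rw [← integral_indicator measurableSet_Iio]
    rfl
  simp_rw [h1]
  rw [integral_integral_swap]
  · refine integral_congr_ae (ae_of_all _ fun u => ?_)
    have : (fun x => {p : ℝ × ℝ | p.2 < p.1}.indicator (fun p => s p.2) (x, u)) =
        (Ioi u).indicator (fun _ => s u) := rfl
    simp only [this]
    rw [integral_indicator measurableSet_Ioi, setIntegral_const, cdf_eq_real, ← compl_Iic,
      probReal_compl_eq_one_sub measurableSet_Iic, smul_eq_mul, mul_comm]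
  · exact (hs.comp_snd ν).indicator hm

/-- Upper bound for the Wasserstein distance by smooth duality. -/
theorem W₁_le_of_smooth_dual (ν₁ ν₂ : Measure ℝ) [IsProbabilityMeasure ν₁]
    [IsProbabilityMeasure ν₂] {B : ℝ}
    (hB : ∀ f s : ℝ → ℝ, ContDiff ℝ ((⊤ : ℕ∞) : WithTop ℕ∞) s → HasCompactSupport s →
      (∀ x, |s x| ≤ 1) → (∀ x, HasDerivAt f (s x) x) → (∃ M, ∀ x, |f x| ≤ M) → ∫ x, f x ∂ν₁ - ∫ x, f x ∂ν₂ ≤ B) :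
    W₁ ν₁ ν₂ ≤ ENNReal.ofReal B := by
  refine (W₁_le_lintegral_cdf ν₁ ν₂).trans ?_
  have hc1 : ∀ (ν : Measure ℝ), Measurable (cdf ν) := fun ν => (monotone_cdf ν).measurable
  refine lintegral_abs_le_of_smooth_dual (H := fun x => cdf ν₁ x - cdf ν₂ x)
    ((hc1 ν₁).sub (hc1 ν₂)) (fun x => ?_) fun s hs hsc hs1 => ?_
  · rw [abs_le]
    constructor <;> linarith [cdf_nonneg ν₁ x, cdf_nonneg ν₂ x, cdf_le_one ν₁ x, cdf_le_one ν₂ x]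
  · have hsi : Integrable s := hs.continuous.integrable_of_hasCompactSupport hsc
    have hsi' : ∀ ν : Measure ℝ, Integrable (fun u => s u * (1 - cdf ν u)) := fun ν => by
      refine hsi.mul_bdd (c := 1) ((measurable_const.sub (hc1 ν)).aestronglyMeasurable)
        (ae_of_all _ fun u => ?_)
      rw [Real.norm_eq_abs, abs_le]
      constructor <;> linarith [cdf_nonneg ν u, cdf_le_one ν u]
    -- The sign compensates for the factor 1 - cdf in `integral_primitive_eq`.
    have := hB (fun x => -∫ u in Iio x, s u) (fun x => -s x) hs.neg hsc.neg
      (fun x => by rw [abs_neg]; exact hs1 x) (fun x => ?_) ⟨∫ u, |s u|, fun x => ?_⟩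
    · rw [integral_neg, integral_neg, integral_primitive_eq ν₁ hsi, integral_primitive_eq ν₂ hsi,
        neg_sub_neg, ← integral_sub (hsi' _) (hsi' _)] at this
      refine le_trans (le_of_eq ?_) this
      congr 1
      ext u
      ring
    · have heq : (fun x => ∫ u in Iio x, s u) =
          fun x => (∫ u in Iic 0, s u) + ∫ u in (0 : ℝ)..x, s u := by
        ext y
        rw [← integral_Iic_eq_integral_Iio,
          ← intervalIntegral.integral_Iic_sub_Iic hsi.integrableOn hsi.integrableOn]
        ring
      refine HasDerivAt.neg ?_
      rw [heq]
      exact (intervalIntegral.integral_hasDerivAt_right hsi.intervalIntegrable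
        hs.continuous.stronglyMeasurable.stronglyMeasurableAtFilter
        hs.continuous.continuousAt).const_add _
    · rw [abs_neg, ← Real.norm_eq_abs]
      exact (norm_integral_le_integral_norm _).trans
        (setIntegral_le_integral hsi.norm (ae_of_all _ fun u => norm_nonneg _))

end Wasserstein

/-! ### Gaussian smoothing: heat equation, derivative bounds and Taylor expansions. -/

section Heat

/-- The Gaussian average `E h (x + √t Z)`. -/
noncomputable def heat (h : ℝ → ℝ) (t x : ℝ) : ℝ := ∫ z, h (x + √t * z) ∂(gaussianReal 0 1)

lemma integrable_polynomial_gaussianReal (q : Polynomial ℝ) :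
    Integrable (fun z => q.eval z) (gaussianReal 0 1) := by
  simp_rw [Polynomial.eval_eq_sum_range]
  refine integrable_finsetSum _ fun n _ => Integrable.const_mul ?_ _
  have := (memLp_id_gaussianReal (μ := 0) (v := 1) (n : ℝ≥0)).integrable_norm_rpow'
  refine this.mono (by fun_prop) (ae_of_all _ fun z => ?_)
  simp

lemma integrable_comp_of_bounded {h : ℝ → ℝ} (hc : Continuous h) {M : ℝ} (hM : ∀ x, |h x| ≤ M)
    (t x : ℝ) : Integrable (fun z => h (x + √t * z)) (gaussianReal 0 1) :=
  Integrable.of_bound (by fun_prop) M (ae_of_all _ fun z => hM _)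

lemma integrable_polynomial_mul_comp {h : ℝ → ℝ} (hc : Continuous h) {M : ℝ}
    (hM : ∀ x, |h x| ≤ M) (q : Polynomial ℝ) (t x : ℝ) :
    Integrable (fun z => q.eval z * h (x + √t * z)) (gaussianReal 0 1) :=
  (integrable_polynomial_gaussianReal q).mul_bdd (c := M) (by fun_prop) (ae_of_all _ fun z => hM _)

lemma hasDerivAt_gaussianPDFReal (z : ℝ) :
    HasDerivAt (gaussianPDFReal 0 1) (-(z * gaussianPDFReal 0 1 z)) z := by
  have h1 : HasDerivAt (fun z : ℝ => -(z - 0) ^ 2 / (2 * ((1 : ℝ≥0) : ℝ))) (-z) z := by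
    have := (((hasDerivAt_id z).sub_const 0).pow 2).neg.div_const (2 * ((1 : ℝ≥0) : ℝ))
    convert! this using 1
    simp
    ring
  have := (h1.exp).const_mul ((√(2 * Real.pi * ((1 : ℝ≥0) : ℝ)))⁻¹)
  rw [gaussianPDFReal_def]
  convert! this using 1
  ring

lemma integrable_gaussianReal_iff {g : ℝ → ℝ} :
    Integrable g (gaussianReal 0 1) ↔ Integrable (fun z => gaussianPDFReal 0 1 z * g z) := by
  rw [gaussianReal_of_var_ne_zero 0 one_ne_zero, gaussianPDF_def,
    integrable_withDensity_iff_integrable_smul' (by fun_prop) (by simp)]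
  simp [ENNReal.toReal_ofReal (gaussianPDFReal_nonneg _ _ _)]

/-- Gaussian integration by parts against a polynomial weight. -/
lemma gaussian_integral_by_parts {h h' : ℝ → ℝ} (hd : ∀ x, HasDerivAt h (h' x) x)
    (hc' : Continuous h') {M M' : ℝ} (hM : ∀ x, |h x| ≤ M) (hM' : ∀ x, |h' x| ≤ M')
    (q : Polynomial ℝ) {t : ℝ} (ht : 0 < t) (x : ℝ) :
    ∫ z, q.eval z * h' (x + √t * z) ∂(gaussianReal 0 1) =
      (√t)⁻¹ * ∫ z, (Polynomial.X * q - Polynomial.derivative q).eval z * h (x + √t * z)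
        ∂(gaussianReal 0 1) := by
  have hc : Continuous h := continuous_iff_continuousAt.2 fun x => (hd x).continuousAt
  have hst : √t ≠ 0 := (Real.sqrt_pos.2 ht).ne'
  have hu : ∀ z, HasDerivAt (fun z => gaussianPDFReal 0 1 z * q.eval z)
      (-(gaussianPDFReal 0 1 z * (Polynomial.X * q - Polynomial.derivative q).eval z)) z := by
    intro z
    have := (hasDerivAt_gaussianPDFReal z).mul (q.hasDerivAt z)
    convert! this using 1
    simp only [Polynomial.eval_sub, Polynomial.eval_mul, Polynomial.eval_X]
    ring
  have hv : ∀ z, HasDerivAt (fun z => h (x + √t * z)) (√t * h' (x + √t * z)) z := by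
    intro z
    have h1 : HasDerivAt (fun z => x + √t * z) (√t) z := by
      simpa using ((hasDerivAt_id z).const_mul (√t)).const_add x
    have := (hd (x + √t * z)).comp z h1
    convert! this using 1
    ring
  have i1 := integrable_gaussianReal_iff.1 (integrable_polynomial_mul_comp hc' hM' q t x)
  have i2 := integrable_gaussianReal_iff.1 (integrable_polynomial_mul_comp hc hM
    (Polynomial.X * q - Polynomial.derivative q) t x)
  have i3 := integrable_gaussianReal_iff.1 (integrable_polynomial_mul_comp hc hM q t x)
  have key := integral_mul_deriv_eq_deriv_mul_of_integrable (fun z _ => hu z) (fun z _ => hv z)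
    (by
      refine (i1.const_mul (√t)).congr (ae_of_all _ fun z => ?_)
      simp only [Pi.mul_apply]
      ring)
    (by
      refine i2.neg.congr (ae_of_all _ fun z => ?_)
      simp only [Pi.mul_apply, Pi.neg_apply]
      ring)
    (by
      refine i3.congr (ae_of_all _ fun z => ?_)
      simp only [Pi.mul_apply]
      ring)
  rw [integral_gaussianReal_eq_integral_smul one_ne_zero,
    integral_gaussianReal_eq_integral_smul one_ne_zero]
  simp only [smul_eq_mul]
  rw [eq_inv_mul_iff_mul_eq₀ hst, ← integral_const_mul]
  have e1 : (fun z => √t * (gaussianPDFReal 0 1 z * (q.eval z * h' (x + √t * z)))) =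
      fun z => gaussianPDFReal 0 1 z * q.eval z * (√t * h' (x + √t * z)) := by
    ext z; ring
  rw [e1, key, ← integral_neg]
  congr 1
  ext z
  ring

lemma hasDerivAt_heat {h h' : ℝ → ℝ} (hd : ∀ x, HasDerivAt h (h' x) x)
    (hc' : Continuous h') {M M' : ℝ} (hM : ∀ x, |h x| ≤ M) (hM' : ∀ x, |h' x| ≤ M') (t x : ℝ) :
    HasDerivAt (heat h t) (heat h' t x) x := by
  have hc : Continuous h := continuous_iff_continuousAt.2 fun x => (hd x).continuousAt
  refine (hasDerivAt_integral_of_dominated_loc_of_deriv_le (s := Set.univ)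
    (F := fun x z => h (x + √t * z)) (F' := fun x z => h' (x + √t * z)) (bound := fun _ => M')
    univ_mem ?_ (integrable_comp_of_bounded hc hM t x) ?_ ?_ (integrable_const _) ?_).2
  · exact Eventually.of_forall fun y => (integrable_comp_of_bounded hc hM t y).aestronglyMeasurable
  · exact (integrable_comp_of_bounded hc' hM' t x).aestronglyMeasurable
  · exact ae_of_all _ fun z y _ => hM' _
  · refine ae_of_all _ fun z y _ => ?_
    have := (hd (y + √t * z)).comp y ((hasDerivAt_id y).add_const (√t * z))
    rwa [mul_one] at this

lemma abs_heat_le {h : ℝ → ℝ} {M : ℝ} (hM : ∀ x, |h x| ≤ M) (t x : ℝ) : |heat h t x| ≤ M := by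
  have := norm_integral_le_of_norm_le_const (μ := gaussianReal 0 1) (f := fun z => h (x + √t * z))
    (C := M) (ae_of_all _ fun z => hM _)
  simpa [heat] using this

/-- The heat equation for Gaussian averages. -/
lemma hasDerivAt_heat_time {h h' h'' : ℝ → ℝ} (hd : ∀ x, HasDerivAt h (h' x) x)
    (hd' : ∀ x, HasDerivAt h' (h'' x) x) (hc'' : Continuous h'') {M M' M'' : ℝ}
    (hM : ∀ x, |h x| ≤ M) (hM' : ∀ x, |h' x| ≤ M') (hM'' : ∀ x, |h'' x| ≤ M'')
    {t : ℝ} (ht : 0 < t) (x : ℝ) :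
    HasDerivAt (fun t => heat h t x) (heat h'' t x / 2) t := by
  have hc : Continuous h := continuous_iff_continuousAt.2 fun x => (hd x).continuousAt
  have hc' : Continuous h' := continuous_iff_continuousAt.2 fun x => (hd' x).continuousAt
  have hst : √t ≠ 0 := (Real.sqrt_pos.2 ht).ne'
  have hz := integrable_polynomial_gaussianReal Polynomial.X
  simp only [Polynomial.eval_X] at hz
  have hM'0 : 0 ≤ M' := (abs_nonneg _).trans (hM' 0)
  -- Times above t / 2 keep 1 / √y bounded, which gives an integrable majorant.
  have key := (hasDerivAt_integral_of_dominated_loc_of_deriv_le (s := Set.Ioi (t / 2))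
    (μ := gaussianReal 0 1) (x₀ := t)
    (F := fun t z => h (x + √t * z)) (F' := fun t z => h' (x + √t * z) * (1 / (2 * √t) * z))
    (bound := fun z => M' * (1 / (2 * √(t / 2)) * |z|))
    (Ioi_mem_nhds (by linarith)) ?_ (integrable_comp_of_bounded hc hM t x) ?_ ?_
    ((hz.abs.const_mul _).const_mul _) ?_).2
  · convert! key using 1
    -- Differentiating √t produces z h' / (2√t); integration by parts absorbs z and turns h' into
    -- h''.
    have ibp := gaussian_integral_by_parts hd' hc'' hM' hM'' 1 ht x
    simp only [Polynomial.eval_one, one_mul, mul_one, Polynomial.derivative_one, sub_zero,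
      Polynomial.eval_X] at ibp
    rw [heat, ibp]
    have e : (fun z => h' (x + √t * z) * (1 / (2 * √t) * z)) =
        fun z => 1 / (2 * √t) * (z * h' (x + √t * z)) := by
      ext z; ring
    rw [e, integral_const_mul]
    field_simp
  · exact Eventually.of_forall fun y => (integrable_comp_of_bounded hc hM y x).aestronglyMeasurable
  · fun_prop
  · refine ae_of_all _ fun z y hy => ?_
    have hy : t / 2 < y := hy
    rw [norm_mul, norm_mul, Real.norm_eq_abs, Real.norm_eq_abs, Real.norm_eq_abs,
      abs_of_nonneg (by positivity : (0 : ℝ) ≤ 1 / (2 * √y))]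
    have : 0 < √(t / 2) := Real.sqrt_pos.2 (by linarith)
    gcongr
    exact hM' _
  · refine ae_of_all _ fun z y hy => ?_
    have hy : t / 2 < y := hy
    have h1 : HasDerivAt (fun y => x + √y * z) (1 / (2 * √y) * z) y :=
      ((Real.hasDerivAt_sqrt (by linarith : y ≠ 0)).mul_const z).const_add x
    exact (hd (x + √y * z)).comp y h1

lemma abs_sub_le_of_hasDerivAt {g g' : ℝ → ℝ} {a b C : ℝ}
    (hd : ∀ u ∈ Set.uIcc a b, HasDerivAt g (g' u) u) (hC : ∀ u ∈ Set.uIcc a b, |g' u| ≤ C) :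
    |g b - g a| ≤ C * |b - a| :=
  (convex_uIcc a b).norm_image_sub_le_of_norm_hasDerivWithin_le
    (fun u hu => (hd u hu).hasDerivWithinAt) hC Set.left_mem_uIcc Set.right_mem_uIcc

/-- First order Taylor estimate for a function with Lipschitz derivative. -/
lemma abs_taylor_one_le {g g' : ℝ → ℝ} {L a b : ℝ}
    (hd : ∀ u ∈ Set.uIcc a b, HasDerivAt g (g' u) u)
    (hL : ∀ u ∈ Set.uIcc a b, |g' u - g' a| ≤ L * |u - a|) (hL0 : 0 ≤ L) :
    |g b - g a - g' a * (b - a)| ≤ L * (b - a) ^ 2 := by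
  have := abs_sub_le_of_hasDerivAt (g := fun u => g u - g' a * u) (g' := fun u => g' u - g' a)
    (a := a) (b := b) (C := L * |b - a|)
    (fun u hu => by
      convert! (hd u hu).sub ((hasDerivAt_id u).const_mul (g' a)) using 1
      rw [mul_one])
    (fun u hu => (hL u hu).trans
      (mul_le_mul_of_nonneg_left (Set.abs_sub_left_of_mem_uIcc hu) hL0))
  calc |g b - g a - g' a * (b - a)| = |g b - g' a * b - (g a - g' a * a)| := by ring_nf
    _ ≤ L * |b - a| * |b - a| := this
    _ = L * (b - a) ^ 2 := by rw [mul_assoc, abs_mul_abs_self, sq]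

/-- Second order Taylor estimate for a function with Lipschitz second derivative. -/
lemma abs_taylor_two_le {g g' g'' : ℝ → ℝ} {L a b : ℝ} (hd : ∀ u, HasDerivAt g (g' u) u)
    (hd' : ∀ u, HasDerivAt g' (g'' u) u) (hL : ∀ u v, |g'' u - g'' v| ≤ L * |u - v|)
    (hL0 : 0 ≤ L) :
    |g b - g a - g' a * (b - a) - g'' a * (b - a) ^ 2 / 2| ≤ L * |b - a| ^ 3 := by
  have h1 : ∀ u, HasDerivAt (fun u => g u - g' a * (u - a) - g'' a * (u - a) ^ 2 / 2)
      (g' u - g' a - g'' a * (u - a)) u := by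
    intro u
    have e1 := (hd u).sub (((hasDerivAt_id u).sub_const a).const_mul (g' a))
    have e2 := e1.sub (((((hasDerivAt_id u).sub_const a).pow 2).const_mul (g'' a)).div_const 2)
    convert! e2 using 1
    simp
    ring
  have := abs_sub_le_of_hasDerivAt (a := a) (b := b) (C := L * |b - a| ^ 2) (fun u _ => h1 u)
    (fun u hu => (abs_taylor_one_le (fun v _ => hd' v) (fun v _ => hL v a) hL0).trans (by
      rw [← sq_abs]
      have := Set.abs_sub_left_of_mem_uIcc hu
      gcongr))
  calc |g b - g a - g' a * (b - a) - g'' a * (b - a) ^ 2 / 2|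
      = |(g b - g' a * (b - a) - g'' a * (b - a) ^ 2 / 2)
          - (g a - g' a * (a - a) - g'' a * (a - a) ^ 2 / 2)| := by ring_nf
    _ ≤ L * |b - a| ^ 2 * |b - a| := this
    _ = _ := by ring

/-- The third and fourth spatial derivatives of the Gaussian average of a primitive of a function
bounded by `1` are `O (1 / t)` and `O (1 / t ^ (3 / 2))`. -/
lemma exists_abs_heat_deriv_le : ∃ c : ℝ, 0 < c ∧ ∀ s s₁ s₂ s₃ : ℝ → ℝ,
    (∀ x, HasDerivAt s (s₁ x) x) → (∀ x, HasDerivAt s₁ (s₂ x) x) →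
    (∀ x, HasDerivAt s₂ (s₃ x) x) → Continuous s₃ → (∀ x, |s x| ≤ 1) →
    (∃ M, ∀ x, |s₁ x| ≤ M ∧ |s₂ x| ≤ M ∧ |s₃ x| ≤ M) →
    ∀ t, 0 < t → ∀ x, |heat s₂ t x| ≤ c / t ∧ |heat s₃ t x| ≤ c / (t * √t) := by
  -- These are the Hermite polynomials. Each integration by parts moves one derivative from s to the
  -- Gaussian weight, at the cost of a factor 1 / √t.
  obtain ⟨q, hq0, hq⟩ : ∃ q : ℕ → Polynomial ℝ, q 0 = 1 ∧
      ∀ n, q (n + 1) = Polynomial.X * q n - Polynomial.derivative (q n) :=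
    ⟨fun n => n.rec 1 (fun _ p => Polynomial.X * p - Polynomial.derivative p), rfl, fun _ => rfl⟩
  refine ⟨1 + ∫ z, |(q 2).eval z| ∂(gaussianReal 0 1) + ∫ z, |(q 3).eval z| ∂(gaussianReal 0 1),
    by positivity, ?_⟩
  rintro s s₁ s₂ s₃ h1 h2 h3 hc3 hs ⟨M, hM⟩ t ht x
  have hst : 0 < √t := Real.sqrt_pos.2 ht
  have hsq : √t * √t = t := Real.mul_self_sqrt ht.le
  have hc2 : Continuous s₂ := continuous_iff_continuousAt.2 fun x => (h3 x).continuousAt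
  have hc1 : Continuous s₁ := continuous_iff_continuousAt.2 fun x => (h2 x).continuousAt
  have i1 := fun q => gaussian_integral_by_parts h1 hc1 hs (fun x => (hM x).1) q ht x
  have i2 := fun q => gaussian_integral_by_parts h2 hc2 (fun x => (hM x).1) (fun x => (hM x).2.1)
    q ht x
  have i3 := fun q => gaussian_integral_by_parts h3 hc3 (fun x => (hM x).2.1)
    (fun x => (hM x).2.2) q ht x
  have hb : ∀ n, |∫ z, (q n).eval z * s (x + √t * z) ∂(gaussianReal 0 1)| ≤
      ∫ z, |(q n).eval z| ∂(gaussianReal 0 1) := by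
    intro n
    rw [← Real.norm_eq_abs]
    refine norm_integral_le_of_norm_le (integrable_polynomial_gaussianReal (q n)).abs
      (ae_of_all _ fun z => ?_)
    rw [norm_mul]
    exact mul_le_of_le_one_right (norm_nonneg _) (hs _)
  have n2 : 0 ≤ ∫ z, |(q 2).eval z| ∂(gaussianReal 0 1) := integral_nonneg fun z => abs_nonneg _
  have n3 : 0 ≤ ∫ z, |(q 3).eval z| ∂(gaussianReal 0 1) := integral_nonneg fun z => abs_nonneg _
  constructor
  · have e : heat s₂ t x = t⁻¹ * ∫ z, (q 2).eval z * s (x + √t * z) ∂(gaussianReal 0 1) := by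
      have e1 : heat s₂ t x = ∫ z, (q 0).eval z * s₂ (x + √t * z) ∂(gaussianReal 0 1) := by
        simp [heat, hq0]
      rw [e1, i2, ← hq 0, i1, ← hq 1, ← mul_assoc, ← mul_inv, hsq]
    rw [e, abs_mul, abs_of_pos (inv_pos.2 ht), div_eq_inv_mul]
    gcongr
    linarith [hb 2]
  · have e : heat s₃ t x =
        (t * √t)⁻¹ * ∫ z, (q 3).eval z * s (x + √t * z) ∂(gaussianReal 0 1) := by
      have e1 : heat s₃ t x = ∫ z, (q 0).eval z * s₃ (x + √t * z) ∂(gaussianReal 0 1) := by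
        simp [heat, hq0]
      rw [e1, i3, ← hq 0, i2, ← hq 1, i1, ← hq 2, ← mul_assoc, ← mul_assoc, ← mul_inv, ← mul_inv, hsq]
    rw [e, abs_mul, abs_of_pos (inv_pos.2 (by positivity)), div_eq_inv_mul]
    gcongr
    linarith [hb 3]

/-- Time-space functions `φ₀, φ₁, φ₂` which behave like the Gaussian averages of a Lipschitz
function and of its first two derivatives. -/
structure HeatExpansion (c : ℝ) (φ₀ φ₁ φ₂ : ℝ → ℝ → ℝ) : Prop where
  cont : ∀ t, Continuous (φ₀ t) ∧ Continuous (φ₁ t) ∧ Continuous (φ₂ t)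
  bdd : ∃ M, ∀ t x, |φ₀ t x| ≤ M ∧ |φ₁ t x| ≤ M ∧ |φ₂ t x| ≤ M
  taylor₀ : ∀ κ τ t₁ t₂ x y : ℝ, 0 < κ → κ ^ 2 ≤ τ → τ ≤ t₁ → τ ≤ t₂ →
    |φ₀ t₂ y - φ₀ t₁ x - φ₁ t₁ x * (y - x) - φ₂ t₁ x * ((y - x) ^ 2 + (t₂ - t₁)) / 2| ≤
      c / τ * (|y - x| ^ 3 + |t₂ - t₁| * |y - x| + (t₂ - t₁) ^ 2 / κ)
  taylor₁ : ∀ κ τ t₁ t₂ x y : ℝ, 0 < κ → κ ^ 2 ≤ τ → τ ≤ t₁ → τ ≤ t₂ →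
    |φ₁ t₂ y - φ₁ t₁ x - φ₂ t₁ x * (y - x)| ≤ c / τ * ((y - x) ^ 2 + |t₂ - t₁|)
  taylor₂ : ∀ κ τ t₁ t₂ x y : ℝ, 0 < κ → κ ^ 2 ≤ τ → τ ≤ t₁ → τ ≤ t₂ →
    |φ₂ t₂ y - φ₂ t₁ x| ≤ c / τ * (|y - x| + |t₂ - t₁| / κ)

/-- The functions φ₁ and φ₂ are the averages of s = f' and of s'. One time derivative is half of two
space derivatives, so the errors involve only the third space derivative, O(1/τ), and the fourth,
O(1/τ^{3/2}). The condition κ² ≤ τ bounds the latter by a multiple of 1/(τκ), so that every error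
carries the same factor 1/τ. -/
lemma exists_heatExpansion : ∃ c : ℝ, 0 < c ∧ ∀ f s : ℝ → ℝ,
    ContDiff ℝ ((⊤ : ℕ∞) : WithTop ℕ∞) s → HasCompactSupport s → (∀ x, |s x| ≤ 1) →
    (∀ x, HasDerivAt f (s x) x) → (∃ M, ∀ x, |f x| ≤ M) →
    ∃ φ₁ φ₂, HeatExpansion c (heat f) φ₁ φ₂ := by
  obtain ⟨c, hc, hder⟩ := exists_abs_heat_deriv_le
  refine ⟨2 * c, by positivity, ?_⟩
  rintro f s hs hsc hs1 hf ⟨Mf, hMf⟩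
  have hdC : ∀ g : ℝ → ℝ, ContDiff ℝ ((⊤ : ℕ∞) : WithTop ℕ∞) g → HasCompactSupport g →
      (∀ x, HasDerivAt g (deriv g x) x) ∧ ContDiff ℝ ((⊤ : ℕ∞) : WithTop ℕ∞) (deriv g) ∧
      HasCompactSupport (deriv g) ∧ ∃ M, ∀ x, |deriv g x| ≤ M := by
    intro g hg hgc
    have h2 : ContDiff ℝ ((⊤ : ℕ∞) : WithTop ℕ∞) (deriv g) := (contDiff_infty_iff_deriv.1 hg).2
    exact ⟨fun x => ((contDiff_infty_iff_deriv.1 hg).1 x).hasDerivAt, h2, hgc.deriv,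
      hgc.deriv.exists_bound_of_continuous h2.continuous⟩
  obtain ⟨d0, c1, k1, M1, hM1⟩ := hdC s hs hsc
  obtain ⟨d1, c2, k2, M2, hM2⟩ := hdC _ c1 k1
  obtain ⟨d2, c3, k3, M3, hM3⟩ := hdC _ c2 k2
  set s₁ := deriv s
  set s₂ := deriv s₁
  set s₃ := deriv s₂
  have hb := hder s s₁ s₂ s₃ d0 d1 d2 c3.continuous hs1
    ⟨max M1 (max M2 M3), fun x => ⟨(hM1 x).trans (le_max_left _ _),
      (hM2 x).trans ((le_max_left _ _).trans (le_max_right _ _)),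
      (hM3 x).trans ((le_max_right _ _).trans (le_max_right _ _))⟩⟩
  have x0 := hasDerivAt_heat hf hs.continuous hMf hs1
  have x1 := hasDerivAt_heat d0 c1.continuous hs1 hM1
  have x2 := hasDerivAt_heat d1 c2.continuous hM1 hM2
  have t0 := fun {t : ℝ} (ht : 0 < t) x =>
    hasDerivAt_heat_time hf d0 c1.continuous hMf hs1 hM1 ht x
  have t1 := fun {t : ℝ} (ht : 0 < t) x =>
    hasDerivAt_heat_time d0 d1 c2.continuous hs1 hM1 hM2 ht x
  have t2 := fun {t : ℝ} (ht : 0 < t) x =>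
    hasDerivAt_heat_time d1 d2 c3.continuous hM1 hM2 hM3 ht x
  have mem : ∀ {τ t₁ t₂ t : ℝ}, τ ≤ t₁ → τ ≤ t₂ → t ∈ Set.uIcc t₁ t₂ → τ ≤ t :=
    fun h1 h2 ht => (le_min h1 h2).trans ht.1
  have hb3 : ∀ {τ t : ℝ} (x : ℝ), 0 < τ → τ ≤ t → |heat s₂ t x| ≤ c / τ := by
    intro τ t x hτ ht
    refine (hb t (hτ.trans_le ht) x).1.trans ?_
    gcongr
  have hb4 : ∀ {κ τ t : ℝ} (x : ℝ), 0 < κ → κ ^ 2 ≤ τ → τ ≤ t →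
      |heat s₃ t x| ≤ c / τ / κ := by
    intro κ τ t x hκ hτ ht
    have hτ0 : 0 < τ := lt_of_lt_of_le (by positivity) hτ
    refine (hb t (hτ0.trans_le ht) x).2.trans ?_
    rw [div_div]
    have : κ ≤ √t := Real.le_sqrt_of_sq_le (hτ.trans ht)
    have ht0 : 0 ≤ t := hτ0.le.trans ht
    gcongr
  have lip2 : ∀ {τ t : ℝ} (x y : ℝ), 0 < τ → τ ≤ t →
      |heat s₁ t y - heat s₁ t x| ≤ c / τ * |y - x| := fun x y hτ ht =>
    abs_sub_le_of_hasDerivAt (fun u _ => x2 _ u) (fun u _ => hb3 u hτ ht)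
  have time1 : ∀ {τ t₁ t₂ : ℝ} (x : ℝ), 0 < τ → τ ≤ t₁ → τ ≤ t₂ →
      |heat s t₂ x - heat s t₁ x| ≤ c / τ * |t₂ - t₁| := by
    intro τ t₁ t₂ x hτ h1 h2
    refine abs_sub_le_of_hasDerivAt (fun u hu => t1 (hτ.trans_le (mem h1 h2 hu)) x) fun u hu => ?_
    rw [abs_div, abs_two]
    exact (half_le_self (abs_nonneg _)).trans (hb3 x hτ (mem h1 h2 hu))
  have time2 : ∀ {κ τ t₁ t₂ : ℝ} (x : ℝ), 0 < κ → κ ^ 2 ≤ τ → τ ≤ t₁ → τ ≤ t₂ →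
      |heat s₁ t₂ x - heat s₁ t₁ x| ≤ c / τ / κ * |t₂ - t₁| := by
    intro κ τ t₁ t₂ x hκ hτ h1 h2
    have hτ0 : 0 < τ := lt_of_lt_of_le (by positivity) hτ
    refine abs_sub_le_of_hasDerivAt (fun u hu => t2 (hτ0.trans_le (mem h1 h2 hu)) x) fun u hu => ?_
    rw [abs_div, abs_two]
    exact (half_le_self (abs_nonneg _)).trans (hb4 x hκ hτ (mem h1 h2 hu))
  refine ⟨heat s, heat s₁, ?_, ?_, ?_, ?_, ?_⟩
  · exact fun t => ⟨continuous_iff_continuousAt.2 fun x => (x0 t x).continuousAt,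
      continuous_iff_continuousAt.2 fun x => (x1 t x).continuousAt,
      continuous_iff_continuousAt.2 fun x => (x2 t x).continuousAt⟩
  · exact ⟨max Mf (max 1 M1), fun t x => ⟨(abs_heat_le hMf t x).trans (le_max_left _ _),
      (abs_heat_le hs1 t x).trans ((le_max_left _ _).trans (le_max_right _ _)),
      (abs_heat_le hM1 t x).trans ((le_max_right _ _).trans (le_max_right _ _))⟩⟩
  · intro κ τ t₁ t₂ x y hκ hτ h1 h2
    have hτ0 : 0 < τ := lt_of_lt_of_le (by positivity) hτ
    -- The increment is taken first in space at time t₁, then in time at y; `a3` moves the resulting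
    -- second derivative from y back to x.
    have a1 := abs_taylor_two_le (a := x) (b := y) (x0 t₁) (x1 t₁)
      (fun u v => lip2 v u hτ0 h1) (by positivity)
    have a2 := abs_taylor_one_le (g := fun t => heat f t y) (g' := fun t => heat s₁ t y / 2)
      (a := t₁) (b := t₂) (L := c / τ / κ) (fun u hu => t0 (hτ0.trans_le (mem h1 h2 hu)) y)
      (fun u hu => by
        rw [← sub_div, abs_div, abs_two]
        exact (half_le_self (abs_nonneg _)).trans
          (time2 y hκ hτ h1 (mem h1 h2 hu))) (by positivity)
    have a3 : |(heat s₁ t₁ y - heat s₁ t₁ x) * (t₂ - t₁) / 2| ≤ c / τ * (|t₂ - t₁| * |y - x|) := by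
      rw [abs_div, abs_two, abs_mul]
      refine (half_le_self (by positivity)).trans ?_
      refine (mul_le_mul_of_nonneg_right (lip2 x y hτ0 h1) (abs_nonneg _)).trans (le_of_eq ?_)
      ring
    have hsum := (abs_add_three _ _ _).trans (add_le_add (add_le_add a1 a2) a3)
    have hp : 0 ≤ c / τ * (|y - x| ^ 3 + |t₂ - t₁| * |y - x| + (t₂ - t₁) ^ 2 / κ) := by positivity
    calc _ = _ := by congr 1; ring
      _ ≤ _ := hsum
      _ = c / τ * (|y - x| ^ 3 + |t₂ - t₁| * |y - x| + (t₂ - t₁) ^ 2 / κ) := by ring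
      _ ≤ 2 * (c / τ * (|y - x| ^ 3 + |t₂ - t₁| * |y - x| + (t₂ - t₁) ^ 2 / κ)) := by linarith
      _ = _ := by ring
  · intro κ τ t₁ t₂ x y hκ hτ h1 h2
    have hτ0 : 0 < τ := lt_of_lt_of_le (by positivity) hτ
    have a1 := abs_taylor_one_le (a := x) (b := y) (fun u _ => x1 t₁ u)
      (fun u _ => lip2 x u hτ0 h1) (by positivity)
    have hsum := (abs_add_le _ _).trans (add_le_add a1 (time1 y hτ0 h1 h2))
    have hp : 0 ≤ c / τ * ((y - x) ^ 2 + |t₂ - t₁|) := by positivity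
    calc _ = _ := by congr 1; ring
      _ ≤ _ := hsum
      _ = c / τ * ((y - x) ^ 2 + |t₂ - t₁|) := by ring
      _ ≤ 2 * (c / τ * ((y - x) ^ 2 + |t₂ - t₁|)) := by linarith
      _ = _ := by ring
  · intro κ τ t₁ t₂ x y hκ hτ h1 h2
    have hτ0 : 0 < τ := lt_of_lt_of_le (by positivity) hτ
    have hsum := (abs_add_le _ _).trans (add_le_add (lip2 x y hτ0 h1) (time2 y hκ hτ h1 h2))
    have hp : 0 ≤ c / τ * (|y - x| + |t₂ - t₁| / κ) := by positivity
    calc _ = _ := by congr 1; ring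
      _ ≤ _ := hsum
      _ = c / τ * (|y - x| + |t₂ - t₁| / κ) := by ring
      _ ≤ 2 * (c / τ * (|y - x| + |t₂ - t₁| / κ)) := by linarith
      _ = _ := by ring

lemma integral_gaussianReal_eq_heat (f : ℝ → ℝ) (hf : Continuous f) {v : ℝ} (hv : 0 ≤ v) :
    ∫ x, f x ∂(gaussianReal 0 v.toNNReal) = heat f v 0 := by
  have h : gaussianReal 0 v.toNNReal = (gaussianReal 0 1).map (fun z => √v * z) := by
    rw [gaussianReal_map_const_mul]
    congr 1
    · simp
    · ext
      simp [hv]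
  rw [h, integral_map (by fun_prop) hf.aestronglyMeasurable]
  simp [heat]

/-- Both averages are computed with the same Gaussian variable. This prices the smoothing at the two
ends of the interpolation. -/
lemma abs_heat_sub_heat_le {f : ℝ → ℝ} (hf : LipschitzWith 1 f) {M : ℝ} (hM : ∀ x, |f x| ≤ M)
    (t₁ t₂ x : ℝ) :
    |heat f t₂ x - heat f t₁ x| ≤ |√t₂ - √t₁| * ∫ z, |z| ∂(gaussianReal 0 1) := by
  have hz := integrable_polynomial_gaussianReal Polynomial.X
  simp only [Polynomial.eval_X] at hz
  rw [heat, heat, ← integral_sub (integrable_comp_of_bounded hf.continuous hM _ _)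
    (integrable_comp_of_bounded hf.continuous hM _ _), ← integral_const_mul]
  refine (Real.norm_eq_abs _).symm.trans_le ?_
  refine norm_integral_le_of_norm_le (hz.abs.const_mul _) (ae_of_all _ fun z => ?_)
  have := hf.dist_le_mul (x + √t₂ * z) (x + √t₁ * z)
  rw [dist_eq_norm, dist_eq_norm] at this
  refine this.trans (le_of_eq ?_)
  rw [← abs_mul, Real.norm_eq_abs]
  simp only [NNReal.coe_one, one_mul]
  congr 1
  ring

lemma heat_zero (f : ℝ → ℝ) (x : ℝ) : heat f 0 x = f x := by simp [heat]

end Heat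

/-! ### Square integrable variables: Cauchy–Schwarz and norm comparison. -/

section L2

variable {Ω : Type*} [MeasurableSpace Ω] {μ : Measure Ω}

/-- The `L²` norm of a random variable. -/
noncomputable def l2 (μ : Measure Ω) (F : Ω → ℝ) : ℝ := √(∫ ω, F ω ^ 2 ∂μ)

lemma l2_nonneg (F : Ω → ℝ) : 0 ≤ l2 μ F := Real.sqrt_nonneg _

lemma l2_sq (F : Ω → ℝ) : l2 μ F ^ 2 = ∫ ω, F ω ^ 2 ∂μ :=
  Real.sq_sqrt (integral_nonneg fun _ => sq_nonneg _)

lemma abs_integral_mul_le_l2 {F G : Ω → ℝ} (hF : MemLp F 2 μ) (hG : MemLp G 2 μ) :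
    |∫ ω, F ω * G ω ∂μ| ≤ l2 μ F * l2 μ G := by
  have iF := hF.integrable_sq
  have iG := hG.integrable_sq
  have iFG : Integrable (fun ω => F ω * G ω) μ := hF.integrable_mul hG
  have h : ∀ a : ℝ, 0 ≤ (∫ ω, G ω ^ 2 ∂μ) * (a * a) + (2 * ∫ ω, F ω * G ω ∂μ) * a +
      ∫ ω, F ω ^ 2 ∂μ := by
    intro a
    have h0 : 0 ≤ ∫ ω, (G ω ^ 2 * (a * a) + F ω * G ω * (2 * a) + F ω ^ 2) ∂μ :=
      integral_nonneg fun ω => by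
        change 0 ≤ G ω ^ 2 * (a * a) + F ω * G ω * (2 * a) + F ω ^ 2
        nlinarith [sq_nonneg (F ω + a * G ω)]
    have i12 : Integrable (fun ω => G ω ^ 2 * (a * a) + F ω * G ω * (2 * a)) μ :=
      (iG.mul_const _).add (iFG.mul_const _)
    rw [integral_add i12 iF, integral_add (iG.mul_const _) (iFG.mul_const _), integral_mul_const,
      integral_mul_const] at h0
    linarith
  have hd := discrim_le_zero h
  rw [discrim] at hd
  refine abs_le_of_sq_le_sq ?_ (mul_nonneg (l2_nonneg _) (l2_nonneg _))
  rw [mul_pow, l2_sq, l2_sq]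
  linarith

lemma abs_integral_le_l2 [IsProbabilityMeasure μ] {F : Ω → ℝ} (hF : MemLp F 2 μ) :
    |∫ ω, F ω ∂μ| ≤ l2 μ F := by
  have := abs_integral_mul_le_l2 hF (memLp_const (μ := μ) (p := 2) (1 : ℝ))
  simpa [l2] using this

lemma integral_abs_le_l2 [IsProbabilityMeasure μ] {F : Ω → ℝ} (hF : MemLp F 2 μ) :
    ∫ ω, |F ω| ∂μ ≤ l2 μ F := by
  have := (le_abs_self _).trans (abs_integral_le_l2 hF.abs)
  simpa [l2] using this

lemma l2_mono {F G : Ω → ℝ} (hG : MemLp G 2 μ) {D : ℝ} (hD : 0 ≤ D)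
    (h : ∀ᵐ ω ∂μ, |F ω| ≤ D * |G ω|) : l2 μ F ≤ D * l2 μ G := by
  refine Real.sqrt_le_iff.2 ⟨mul_nonneg hD (l2_nonneg _), ?_⟩
  rw [mul_pow, l2_sq, ← integral_const_mul]
  refine integral_mono_of_nonneg (ae_of_all _ fun ω => sq_nonneg _)
    (hG.integrable_sq.const_mul _) ?_
  filter_upwards [h] with ω hω
  rw [← sq_abs, ← sq_abs (G ω), ← mul_pow]
  gcongr

/-- Made for the increments of φ₁ and φ₂: the jump in space gives |Z l|, and the deterministic jump
in time gives a multiple of its norm. -/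
lemma l2_le_of_abs_le_add [IsProbabilityMeasure μ] {F G : Ω → ℝ} (hG : MemLp G 2 μ) {D A : ℝ}
    (hD : 0 ≤ D) (hA : 0 ≤ A) (h : ∀ᵐ ω ∂μ, |F ω| ≤ D * (|G ω| + A * l2 μ G)) :
    l2 μ F ≤ 2 * D * (1 + A) * l2 μ G := by
  have hG0 := l2_nonneg (μ := μ) G
  refine Real.sqrt_le_iff.2 ⟨by positivity, ?_⟩
  have hi : Integrable (fun ω => D ^ 2 * (2 * G ω ^ 2 + 2 * A ^ 2 * l2 μ G ^ 2)) μ :=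
    ((hG.integrable_sq.const_mul _).add (integrable_const _)).const_mul _
  calc ∫ ω, F ω ^ 2 ∂μ ≤ ∫ ω, D ^ 2 * (2 * G ω ^ 2 + 2 * A ^ 2 * l2 μ G ^ 2) ∂μ := by
        refine integral_mono_of_nonneg (ae_of_all _ fun ω => sq_nonneg _) hi ?_
        filter_upwards [h] with ω hω
        calc F ω ^ 2 = |F ω| ^ 2 := (sq_abs _).symm
          _ ≤ (D * (|G ω| + A * l2 μ G)) ^ 2 := by gcongr
          _ = D ^ 2 * (|G ω| + A * l2 μ G) ^ 2 := by ring
          _ ≤ D ^ 2 * (2 * |G ω| ^ 2 + 2 * (A * l2 μ G) ^ 2) := by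
              gcongr
              nlinarith [sq_nonneg (|G ω| - A * l2 μ G)]
          _ = _ := by rw [sq_abs]; ring
    _ = D ^ 2 * (2 + 2 * A ^ 2) * l2 μ G ^ 2 := by
        rw [integral_const_mul, integral_add (hG.integrable_sq.const_mul _) (integrable_const _),
          integral_const_mul, ← l2_sq]
        simp
        ring
    _ ≤ (2 * D * (1 + A)) ^ 2 * l2 μ G ^ 2 := by
        gcongr
        nlinarith [sq_nonneg D, mul_nonneg (sq_nonneg D) hA, mul_nonneg (sq_nonneg D) (sq_nonneg A)]
    _ = _ := by ring

lemma memLp_top_mul {F G : Ω → ℝ} (hF : MemLp F ∞ μ) (hG : MemLp G ∞ μ) :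
    MemLp (fun ω => F ω * G ω) ∞ μ := hG.mul hF

lemma memLp_two_of_top [IsFiniteMeasure μ] {F : Ω → ℝ} (hF : MemLp F ∞ μ) : MemLp F 2 μ :=
  hF.mono_exponent le_top

lemma integrable_of_memLp_top [IsFiniteMeasure μ] {F : Ω → ℝ} (hF : MemLp F ∞ μ) :
    Integrable F μ := hF.integrable le_top

end L2

/-! ### Summation of mixing rates over one or two gaps. -/

section Sums

open Finset

/-- Exactly 2k + 1 pairs have maximum k, and 2k + 1 ≤ 3k for k ≥ 1, while r vanishes at 0. -/
lemma sum_range_max_le {r : ℕ → ℝ} (hr : ∀ k, 0 ≤ r k) (hr0 : r 0 = 0) {R : ℝ}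
    (hR : ∀ N, ∑ k ∈ range N, k * r k ≤ R) (N : ℕ) :
    ∑ p ∈ range N, ∑ k ∈ range N, r (max p k) ≤ 3 * R := by
  have h : ∀ N, ∑ p ∈ range N, ∑ k ∈ range N, r (max p k) ≤ 3 * ∑ k ∈ range N, k * r k := by
    intro N
    induction N with
    | zero => simp
    | succ N ih =>
      have e1 : ∀ p ∈ range N, r (max p N) = r N := fun p hp => by
        rw [max_eq_right (mem_range.1 hp).le]
      have e2 : ∀ k ∈ range N, r (max N k) = r N := fun k hk => by
        rw [max_eq_left (mem_range.1 hk).le]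
      simp_rw [sum_range_succ]
      rw [sum_add_distrib, sum_congr rfl e1, sum_congr rfl e2]
      simp only [sum_const, card_range, nsmul_eq_mul, max_self]
      have : r N ≤ N * r N := by
        rcases Nat.eq_zero_or_pos N with rfl | hN
        · simp [hr0]
        · exact le_mul_of_one_le_left (hr N) (by exact_mod_cast hN)
      linarith
  exact (h N).trans (by linarith [hR N])

lemma sum_range_le {r : ℕ → ℝ} (hr : ∀ k, 0 ≤ r k) (hr0 : r 0 = 0) {R : ℝ}
    (hR : ∀ N, ∑ k ∈ range N, k * r k ≤ R) (N : ℕ) : ∑ k ∈ range N, r k ≤ R := by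
  refine (sum_le_sum fun k _ => ?_).trans (hR N)
  rcases Nat.eq_zero_or_pos k with rfl | hN
  · simp [hr0]
  · exact le_mul_of_one_le_left (hr k) (by exact_mod_cast hN)

lemma sum_Ico_sub_le {g : ℕ → ℝ} (hg : ∀ k, 0 ≤ g k) (l n : ℕ) :
    ∑ i ∈ Ico l n, g (i - l) ≤ ∑ k ∈ range n, g k := by
  rw [sum_Ico_eq_sum_range]
  simp only [Nat.add_sub_cancel_left]
  exact sum_le_sum_of_subset_of_nonneg (range_mono (Nat.sub_le _ _)) fun k _ _ => hg k

lemma sum_Ico_succ_sub_le {g : ℕ → ℝ} (hg : ∀ k, 0 ≤ g k) (l n : ℕ) :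
    ∑ i ∈ Ico (l + 1) n, g (i - l) ≤ ∑ k ∈ range n, g k :=
  (sum_le_sum_of_subset_of_nonneg (Ico_subset_Ico_left (Nat.le_succ l))
    fun k _ _ => hg _).trans (sum_Ico_sub_le hg l n)

lemma sum_range_sub_le {g : ℕ → ℝ} (hg : ∀ k, 0 ≤ g k) {l n : ℕ} (hl : l < n) :
    ∑ m ∈ range l, g (l - m) ≤ ∑ k ∈ range n, g k := by
  have : ∑ m ∈ range l, g (l - m) = ∑ k ∈ Ico 1 (l + 1), g k := by
    rw [← sum_range_reflect, sum_Ico_eq_sum_range]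
    refine sum_congr (by simp) fun m hm => ?_
    have := mem_range.1 hm
    congr 1
    omega
  rw [this]
  refine sum_le_sum_of_subset_of_nonneg (fun k hk => ?_) fun k _ _ => hg k
  have := mem_Ico.1 hk
  exact mem_range.2 (by omega)

/-- Summation of pair interactions. -/
lemma sum_pair_le {r y : ℕ → ℝ} (hr : ∀ k, 0 ≤ r k) (hr0 : r 0 = 0) (hy : ∀ k, 0 ≤ y k) {R : ℝ}
    (hR : ∀ N, ∑ k ∈ range N, k * r k ≤ R) (n : ℕ) :
    ∑ l ∈ range n, ∑ m ∈ range l, r (l - m) * ((y m + y l) / 2) ≤ R * ∑ l ∈ range n, y l := by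
  have hs := sum_range_le hr hr0 hR
  have h1 : ∑ l ∈ range n, ∑ m ∈ range l, r (l - m) * y l ≤ R * ∑ l ∈ range n, y l := by
    rw [mul_sum]
    refine sum_le_sum fun l hl => ?_
    rw [← sum_mul]
    exact mul_le_mul_of_nonneg_right
      ((sum_range_sub_le hr (mem_range.1 hl)).trans (hs n)) (hy l)
  have h2 : ∑ l ∈ range n, ∑ m ∈ range l, r (l - m) * y m ≤ R * ∑ l ∈ range n, y l := by
    rw [sum_comm' (t' := range n) (s' := fun m => Ico (m + 1) n), mul_sum]
    · refine sum_le_sum fun m _ => ?_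
      rw [← sum_mul]
      exact mul_le_mul_of_nonneg_right ((sum_Ico_succ_sub_le hr m n).trans (hs n)) (hy m)
    · intro l m
      simp only [mem_range, mem_Ico]
      omega
  calc _ = (∑ l ∈ range n, ∑ m ∈ range l, r (l - m) * y l
        + ∑ l ∈ range n, ∑ m ∈ range l, r (l - m) * y m) / 2 := by
        simp_rw [← sum_add_distrib, sum_div]
        refine sum_congr rfl fun l _ => sum_congr rfl fun m _ => ?_
        ring
    _ ≤ _ := by linarith

/-- Summation of triple interactions. -/
lemma sum_triple_le {r y : ℕ → ℝ} (hr : ∀ k, 0 ≤ r k) (hr0 : r 0 = 0) (hy : ∀ k, 0 ≤ y k)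
    {R : ℝ} (hR : ∀ N, ∑ k ∈ range N, k * r k ≤ R) (n : ℕ) :
    ∑ l ∈ range n, ∑ i ∈ Ico l n, ∑ m ∈ range l, r (max (l - m) (i - l)) * ((y m + y i) / 2) ≤
      3 * R * ∑ l ∈ range n, y l := by
  have hs := sum_range_max_le hr hr0 hR n
  -- With the weight at i fixed, l and m are determined by the gaps i - l and l - m, so
  -- `sum_range_max_le` bounds the coefficient of y i. In `h2` the index m is fixed instead.
  have h1 : ∑ l ∈ range n, ∑ i ∈ Ico l n, ∑ m ∈ range l, r (max (l - m) (i - l)) * y i ≤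
      3 * R * ∑ l ∈ range n, y l := by
    rw [sum_comm' (t' := range n) (s' := fun i => range (i + 1)), mul_sum]
    · refine sum_le_sum fun i hi => ?_
      simp_rw [← sum_mul]
      refine mul_le_mul_of_nonneg_right ?_ (hy i)
      calc ∑ l ∈ range (i + 1), ∑ m ∈ range l, r (max (l - m) (i - l))
          ≤ ∑ l ∈ range (i + 1), ∑ p ∈ range n, r (max p (i - l)) := by
            refine sum_le_sum fun l hl => ?_
            have h1 := mem_range.1 hl
            have h2 := mem_range.1 hi
            exact sum_range_sub_le (g := fun p => r (max p (i - l))) (fun _ => hr _) (by omega)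
        _ = ∑ k ∈ range (i + 1), ∑ p ∈ range n, r (max p k) := by
            rw [← sum_range_reflect]
            refine sum_congr rfl fun k hk => ?_
            have := mem_range.1 hk
            refine sum_congr rfl fun p _ => ?_
            congr 2
            omega
        _ ≤ ∑ k ∈ range n, ∑ p ∈ range n, r (max p k) :=
            sum_le_sum_of_subset_of_nonneg (range_mono (mem_range.1 hi))
              fun k _ _ => sum_nonneg fun p _ => hr _
        _ ≤ 3 * R := by rwa [sum_comm]
    · intro l i
      simp only [mem_range, mem_Ico]
      omega
  have h2 : ∑ l ∈ range n, ∑ i ∈ Ico l n, ∑ m ∈ range l, r (max (l - m) (i - l)) * y m ≤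
      3 * R * ∑ l ∈ range n, y l := by
    have e : ∀ l ∈ range n, ∑ i ∈ Ico l n, ∑ m ∈ range l, r (max (l - m) (i - l)) * y m =
        ∑ m ∈ range l, ∑ i ∈ Ico l n, r (max (l - m) (i - l)) * y m := fun l _ => sum_comm
    rw [sum_congr rfl e, sum_comm' (t' := range n) (s' := fun m => Ico (m + 1) n), mul_sum]
    · refine sum_le_sum fun m _ => ?_
      simp_rw [← sum_mul]
      refine mul_le_mul_of_nonneg_right ?_ (hy m)
      calc ∑ l ∈ Ico (m + 1) n, ∑ i ∈ Ico l n, r (max (l - m) (i - l))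
          ≤ ∑ l ∈ Ico (m + 1) n, ∑ k ∈ range n, r (max (l - m) k) :=
            sum_le_sum fun l _ =>
              sum_Ico_sub_le (g := fun k => r (max (l - m) k)) (fun _ => hr _) l n
        _ ≤ ∑ p ∈ range n, ∑ k ∈ range n, r (max p k) :=
            sum_Ico_succ_sub_le (g := fun p => ∑ k ∈ range n, r (max p k))
              (fun p => sum_nonneg fun _ _ => hr _) m n
        _ ≤ 3 * R := hs
    · intro l m
      simp only [mem_range, mem_Ico]
      omega
  calc _ = (∑ l ∈ range n, ∑ i ∈ Ico l n, ∑ m ∈ range l, r (max (l - m) (i - l)) * y i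
        + ∑ l ∈ range n, ∑ i ∈ Ico l n, ∑ m ∈ range l, r (max (l - m) (i - l)) * y m) / 2 := by
        simp_rw [← sum_add_distrib, sum_div]
        refine sum_congr rfl fun l _ => sum_congr rfl fun i _ => sum_congr rfl fun m _ => ?_
        ring
    _ ≤ _ := by linarith

end Sums

/-! ### Decay of correlations, one Lindeberg step and increment bounds. -/

section Lindeberg

open Finset

variable {Ω : Type*} {mΩ : MeasurableSpace Ω} {μ : Measure Ω} [IsProbabilityMeasure μ]
  {Z : ℕ → Ω → ℝ} {𝓕 : Filtration ℕ mΩ} {r : ℕ → ℝ} {K R : ℝ}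

/-- A centered sequence bounded by `K`, adapted to a filtration, whose instants and pairs of
instants decorrelate from the past at rate `r`, with `∑ k r(k) ≤ R`. -/
structure CorrelationDecay (μ : Measure Ω) (Z : ℕ → Ω → ℝ) (𝓕 : Filtration ℕ mΩ) (r : ℕ → ℝ)
    (K R : ℝ) : Prop where
  meas : ∀ i, Measurable[𝓕 (i + 1)] (Z i)
  bdd : ∀ i, ∀ᵐ ω ∂μ, |Z i ω| ≤ K
  cent : ∀ i, ∫ ω, Z i ω ∂μ = 0
  cov_one : ∀ m l (F : Ω → ℝ), m < l → Measurable[𝓕 (m + 1)] F → MemLp F 2 μ →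
    |cov[F, Z l; μ]| ≤ r (l - m) * (l2 μ F * l2 μ (Z l))
  cov_two : ∀ m l i (F : Ω → ℝ), m < l → l ≤ i → Measurable[𝓕 (m + 1)] F → MemLp F 2 μ →
    |cov[F, fun ω => Z l ω * Z i ω; μ]| ≤ r (l - m) * (l2 μ F * l2 μ (fun ω => Z l ω * Z i ω))
  r_nonneg : ∀ k, 0 ≤ r k
  r_zero : r 0 = 0
  sum_le : ∀ N, ∑ k ∈ range N, k * r k ≤ R
  K_pos : 0 < K

/-- The variance `E (Z l + ⋯ + Z (n - 1)) ^ 2` of the remaining sum. -/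
noncomputable def tailVar (μ : Measure Ω) (Z : ℕ → Ω → ℝ) (n l : ℕ) : ℝ :=
  ∫ ω, (∑ i ∈ Ico l n, Z i ω) ^ 2 ∂μ

lemma tailVar_nonneg (n l : ℕ) : 0 ≤ tailVar μ Z n l := integral_nonneg fun _ => sq_nonneg _

namespace CorrelationDecay

lemma R_nonneg (h : CorrelationDecay μ Z 𝓕 r K R) : 0 ≤ R := by simpa using h.sum_le 0

lemma memLp_top (h : CorrelationDecay μ Z 𝓕 r K R) (i : ℕ) : MemLp (Z i) ∞ μ :=
  memLp_top_of_bound ((h.meas i).mono (𝓕.le _) le_rfl).aestronglyMeasurable K (h.bdd i)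

lemma memLp_two (h : CorrelationDecay μ Z 𝓕 r K R)
    (i : ℕ) : MemLp (Z i) 2 μ := memLp_two_of_top (h.memLp_top i)

lemma l2_mul_le (h : CorrelationDecay μ Z 𝓕 r K R) {F : Ω → ℝ} (hF : MemLp F 2 μ) (i : ℕ) :
    l2 μ (fun ω => F ω * Z i ω) ≤ K * l2 μ F := by
  refine l2_mono hF h.K_pos.le ?_
  filter_upwards [h.bdd i] with ω hω
  rw [abs_mul, mul_comm]
  gcongr

lemma l2_mul_le' (h : CorrelationDecay μ Z 𝓕 r K R) {F : Ω → ℝ} (hF : MemLp F 2 μ) (i : ℕ) :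
    l2 μ (fun ω => Z i ω * F ω) ≤ K * l2 μ F := by
  simp_rw [mul_comm (Z i _)]
  exact h.l2_mul_le hF i

lemma l2_le (h : CorrelationDecay μ Z 𝓕 r K R) (i : ℕ) : l2 μ (Z i) ≤ K := by
  have := h.l2_mul_le' (memLp_const (1 : ℝ)) i
  simpa [l2] using this

lemma cov_one_eq (h : CorrelationDecay μ Z 𝓕 r K R) {F : Ω → ℝ} (hF : MemLp F 2 μ) (l : ℕ) :
    cov[F, Z l; μ] = ∫ ω, F ω * Z l ω ∂μ := by
  rw [covariance_eq_sub hF (h.memLp_two l), h.cent l, mul_zero, sub_zero]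
  rfl

lemma abs_integral_mul_le (h : CorrelationDecay μ Z 𝓕 r K R) {l i : ℕ} (hli : l < i) :
    |∫ ω, Z l ω * Z i ω ∂μ| ≤ r (i - l) * (l2 μ (Z l) * l2 μ (Z i)) := by
  rw [← h.cov_one_eq (h.memLp_two l)]
  exact h.cov_one l i _ hli (h.meas l) (h.memLp_two l)

lemma tailVar_sub (h : CorrelationDecay μ Z 𝓕 r K R) {n l : ℕ} (hl : l < n) :
    tailVar μ Z n l - tailVar μ Z n (l + 1) =
      (∫ ω, Z l ω ^ 2 ∂μ) + 2 * ∑ i ∈ Ico (l + 1) n, ∫ ω, Z l ω * Z i ω ∂μ := by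
  have hT : MemLp (fun ω => ∑ i ∈ Ico (l + 1) n, Z i ω) 2 μ :=
    memLp_finsetSum _ fun i _ => h.memLp_two i
  have hp : ∀ i, Integrable (fun ω => Z l ω * Z i ω) μ :=
    fun i => (h.memLp_two l).integrable_mul (h.memLp_two i)
  have e : ∀ ω, (∑ i ∈ Ico l n, Z i ω) ^ 2 =
      Z l ω ^ 2 + 2 * (∑ i ∈ Ico (l + 1) n, Z l ω * Z i ω) +
        (∑ i ∈ Ico (l + 1) n, Z i ω) ^ 2 := by
    intro ω
    rw [sum_eq_sum_Ico_succ_bot hl, ← mul_sum]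
    ring
  rw [tailVar, tailVar, integral_congr_ae (ae_of_all _ e)]
  have i1 : Integrable (fun ω => 2 * ∑ i ∈ Ico (l + 1) n, Z l ω * Z i ω) μ :=
    (integrable_finsetSum _ fun i _ => hp i).const_mul 2
  have i2 : Integrable (fun ω => Z l ω ^ 2 + 2 * ∑ i ∈ Ico (l + 1) n, Z l ω * Z i ω) μ :=
    (h.memLp_two l).integrable_sq.add i1
  rw [integral_add i2 hT.integrable_sq, integral_add (h.memLp_two l).integrable_sq i1,
    integral_const_mul, integral_finsetSum _ fun i _ => hp i]
  ring

/-- In each covariance one norm is kept and the other is bounded by K. The square of this bound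
divided by K is then of order K E Z_l², matching the other remainders. -/
lemma abs_tailVar_sub_le (h : CorrelationDecay μ Z 𝓕 r K R) {n l : ℕ} (hl : l < n) :
    |tailVar μ Z n (l + 1) - tailVar μ Z n l| ≤ (1 + 2 * R) * K * l2 μ (Z l) := by
  have hb := l2_nonneg (μ := μ) (Z l)
  rw [abs_sub_comm, h.tailVar_sub hl, ← l2_sq]
  have h1 : |∑ i ∈ Ico (l + 1) n, ∫ ω, Z l ω * Z i ω ∂μ| ≤ R * (l2 μ (Z l) * K) := by
    calc _ ≤ ∑ i ∈ Ico (l + 1) n, |∫ ω, Z l ω * Z i ω ∂μ| := abs_sum_le_sum_abs _ _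
      _ ≤ ∑ i ∈ Ico (l + 1) n, r (i - l) * (l2 μ (Z l) * K) := by
          refine sum_le_sum fun i hi => (h.abs_integral_mul_le (mem_Ico.1 hi).1).trans ?_
          have := h.r_nonneg (i - l)
          have := h.l2_le i
          gcongr
      _ ≤ _ := by
          rw [← sum_mul]
          have hK := h.K_pos
          gcongr
          exact (sum_Ico_succ_sub_le h.r_nonneg l n).trans
            (sum_range_le h.r_nonneg h.r_zero h.sum_le n)
  have h2 : l2 μ (Z l) ^ 2 ≤ K * l2 μ (Z l) := by
    rw [sq]
    exact mul_le_mul_of_nonneg_right (h.l2_le l) hb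
  rw [abs_le] at h1 ⊢
  constructor <;> nlinarith [sq_nonneg (l2 μ (Z l)), h1.1, h1.2]

variable {c : ℝ} {φ₀ φ₁ φ₂ : ℝ → ℝ → ℝ} {n : ℕ} {w : ℕ → ℝ}

lemma measurable_partialSum (h : CorrelationDecay μ Z 𝓕 r K R) (l : ℕ) :
    Measurable[𝓕 l] (fun ω => ∑ i ∈ range l, Z i ω) := by
  refine Finset.measurable_fun_sum _ fun i hi => ?_
  exact (h.meas i).mono (𝓕.mono (mem_range.1 hi)) le_rfl

lemma measurable_comp_partialSum (h : CorrelationDecay μ Z 𝓕 r K R)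
    {g : ℝ → ℝ} (hg : Continuous g) (l : ℕ) :
    Measurable[𝓕 l] (fun ω => g (∑ i ∈ range l, Z i ω)) :=
  hg.measurable.comp (h.measurable_partialSum l)

lemma memLp_comp_partialSum (h : CorrelationDecay μ Z 𝓕 r K R)
    {g : ℝ → ℝ} (hg : Continuous g) {M : ℝ} (hM : ∀ x, |g x| ≤ M)
    (l : ℕ) : MemLp (fun ω => g (∑ i ∈ range l, Z i ω)) ∞ μ :=
  memLp_top_of_bound
    ((h.measurable_comp_partialSum hg l).mono (𝓕.le _) le_rfl).aestronglyMeasurable M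
    (ae_of_all _ fun _ => hM _)

/-- One step of the Lindeberg method. -/
lemma abs_step_le (h : CorrelationDecay μ Z 𝓕 r K R)
    (hc : 0 ≤ c) (hφ : HeatExpansion c φ₀ φ₁ φ₂) {t : ℕ → ℝ}
    (ht : ∀ l, t l = K ^ 2 + tailVar μ Z n l) {l : ℕ} (hl : l < n) (hw : K ^ 2 ≤ w l)
    (hw0 : w l ≤ t l) (hw1 : w l ≤ t (l + 1)) :
    |(∫ ω, φ₀ (t (l + 1)) (∑ i ∈ range (l + 1), Z i ω) ∂μ
        - ∫ ω, φ₀ (t l) (∑ i ∈ range l, Z i ω) ∂μ)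
      - (∫ ω, φ₁ (t l) (∑ i ∈ range l, Z i ω) * Z l ω ∂μ
        + (∫ ω, φ₂ (t l) (∑ i ∈ range l, Z i ω) * (Z l ω * Z l ω) ∂μ) / 2
        - (t l - t (l + 1)) / 2 * ∫ ω, φ₂ (t l) (∑ i ∈ range l, Z i ω) ∂μ)| ≤
      c * K * (1 + (1 + 2 * R)) ^ 2 * (l2 μ (Z l) ^ 2 / w l) := by
  obtain ⟨M, hM⟩ := hφ.bdd
  have hK := h.K_pos
  have hR := h.R_nonneg
  have hwpos : 0 < w l := lt_of_lt_of_le (by positivity) hw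
  have m0 := h.memLp_comp_partialSum (hφ.cont (t l)).1 (fun x => (hM (t l) x).1) l
  have m0' := h.memLp_comp_partialSum (hφ.cont (t (l + 1))).1 (fun x => (hM (t (l + 1)) x).1)
    (l + 1)
  have m1 := memLp_top_mul
    (h.memLp_comp_partialSum (hφ.cont (t l)).2.1 (fun x => (hM (t l) x).2.1) l) (h.memLp_top l)
  have m2 := h.memLp_comp_partialSum (hφ.cont (t l)).2.2 (fun x => (hM (t l) x).2.2) l
  have m3 := memLp_top_mul m2 (memLp_top_mul (h.memLp_top l) (h.memLp_top l))
  have i0 := integrable_of_memLp_top m0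
  have i0' := integrable_of_memLp_top m0'
  have i1 := integrable_of_memLp_top m1
  have i2 := integrable_of_memLp_top m2
  have i3 := integrable_of_memLp_top m3
  have j1 : Integrable (fun ω => φ₁ (t l) (∑ i ∈ range l, Z i ω) * Z l ω
      + φ₂ (t l) (∑ i ∈ range l, Z i ω) * (Z l ω * Z l ω) / 2) μ := i1.add (i3.div_const 2)
  have j2 : Integrable (fun ω => φ₁ (t l) (∑ i ∈ range l, Z i ω) * Z l ω
      + φ₂ (t l) (∑ i ∈ range l, Z i ω) * (Z l ω * Z l ω) / 2
      - (t l - t (l + 1)) / 2 * φ₂ (t l) (∑ i ∈ range l, Z i ω)) μ := j1.sub (i2.const_mul _)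
  have j0 : Integrable (fun ω => φ₀ (t (l + 1)) (∑ i ∈ range (l + 1), Z i ω)
      - φ₀ (t l) (∑ i ∈ range l, Z i ω)) μ := i0'.sub i0
  rw [← integral_sub i0' i0, ← integral_div, ← integral_const_mul, ← integral_add i1
    (i3.div_const 2), ← integral_sub j1 (i2.const_mul _), ← integral_sub j0 j2,
    ← Real.norm_eq_abs]
  set A := 1 + 2 * R with hA
  have hA0 : 0 ≤ A := by positivity
  set b := l2 μ (Z l) with hb
  have hb0 : 0 ≤ b := l2_nonneg _
  have hsig : |t (l + 1) - t l| ≤ A * K * b := by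
    rw [ht, ht, add_sub_add_left_eq_sub]
    exact h.abs_tailVar_sub_le hl
  have hZ := h.memLp_two l
  have iabs : Integrable (fun ω => |Z l ω|) μ := (integrable_of_memLp_top (h.memLp_top l)).abs
  have k1 : Integrable (fun ω => K * Z l ω ^ 2 + A * K * b * |Z l ω|) μ :=
    (hZ.integrable_sq.const_mul K).add (iabs.const_mul (A * K * b))
  have k2 : Integrable (fun ω => K * Z l ω ^ 2 + A * K * b * |Z l ω| + A ^ 2 * K * b ^ 2) μ :=
    k1.add (integrable_const _)
  have hbnd : ∀ᵐ ω ∂μ, ‖φ₀ (t (l + 1)) (∑ i ∈ range (l + 1), Z i ω)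
      - φ₀ (t l) (∑ i ∈ range l, Z i ω) - (φ₁ (t l) (∑ i ∈ range l, Z i ω) * Z l ω
        + φ₂ (t l) (∑ i ∈ range l, Z i ω) * (Z l ω * Z l ω) / 2
        - (t l - t (l + 1)) / 2 * φ₂ (t l) (∑ i ∈ range l, Z i ω))‖ ≤
      c / w l * (K * Z l ω ^ 2 + A * K * b * |Z l ω| + A ^ 2 * K * b ^ 2) := by
    filter_upwards [h.bdd l] with ω hω
    have key := hφ.taylor₀ K (w l) (t l) (t (l + 1)) (∑ i ∈ range l, Z i ω)
      (∑ i ∈ range (l + 1), Z i ω) hK hw hw0 hw1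
    rw [sum_range_succ, add_sub_cancel_left] at key
    rw [sum_range_succ, Real.norm_eq_abs]
    calc _ = _ := by congr 1; ring
      _ ≤ _ := key
      _ ≤ _ := by
        -- One factor of each cubic remainder is traded for K, leaving a quantity whose expectation
        -- is at most of order E Z_l².
        have e1 : |Z l ω| ^ 3 ≤ K * Z l ω ^ 2 := by
          rw [← sq_abs, pow_succ, mul_comm]
          gcongr
        have e2 : (t (l + 1) - t l) ^ 2 / K ≤ A ^ 2 * K * b ^ 2 := by
          rw [div_le_iff₀ hK, ← sq_abs]
          calc |t (l + 1) - t l| ^ 2 ≤ (A * K * b) ^ 2 := by gcongr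
            _ = _ := by ring
        gcongr
  refine (norm_integral_le_of_norm_le (k2.const_mul _) hbnd).trans ?_
  rw [integral_const_mul, integral_add k1 (integrable_const _),
    integral_add (hZ.integrable_sq.const_mul K) (iabs.const_mul _), integral_const_mul,
    integral_const_mul, ← l2_sq]
  have e3 : ∫ ω, |Z l ω| ∂μ ≤ b := integral_abs_le_l2 hZ
  simp only [integral_const, probReal_univ, one_smul]
  calc c / w l * (K * b ^ 2 + A * K * b * ∫ ω, |Z l ω| ∂μ + A ^ 2 * K * b ^ 2)
      ≤ c / w l * (K * b ^ 2 + A * K * b * b + A ^ 2 * K * b ^ 2) := by gcongr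
    _ = c * K * (1 + A + A ^ 2) * (b ^ 2 / w l) := by ring
    _ ≤ c * K * (1 + A) ^ 2 * (b ^ 2 / w l) := by
        gcongr
        nlinarith

/-- Increments of the first derivative along the sequence. -/
lemma l2_increment_one_le (h : CorrelationDecay μ Z 𝓕 r K R)
    (hc : 0 ≤ c) (hφ : HeatExpansion c φ₀ φ₁ φ₂) {t : ℕ → ℝ}
    (ht : ∀ l, t l = K ^ 2 + tailVar μ Z n l) {l : ℕ} (hl : l < n) (hw : K ^ 2 ≤ w l)
    (hw0 : w l ≤ t l) (hw1 : w l ≤ t (l + 1)) :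
    l2 μ (fun ω => φ₁ (t (l + 1)) (∑ i ∈ range (l + 1), Z i ω)
      - φ₁ (t l) (∑ i ∈ range l, Z i ω) - φ₂ (t l) (∑ i ∈ range l, Z i ω) * Z l ω) ≤
      2 * (c / w l * K) * (1 + (1 + 2 * R)) * l2 μ (Z l) := by
  have hK := h.K_pos
  have hR := h.R_nonneg
  have hwpos : 0 < w l := lt_of_lt_of_le (by positivity) hw
  refine l2_le_of_abs_le_add (h.memLp_two l) (by positivity) (by positivity) ?_
  filter_upwards [h.bdd l] with ω hω
  have key := hφ.taylor₁ K (w l) (t l) (t (l + 1)) (∑ i ∈ range l, Z i ω)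
    (∑ i ∈ range (l + 1), Z i ω) hK hw hw0 hw1
  have hsig : |t (l + 1) - t l| ≤ (1 + 2 * R) * K * l2 μ (Z l) := by
    rw [ht, ht, add_sub_add_left_eq_sub]
    exact h.abs_tailVar_sub_le hl
  rw [sum_range_succ, add_sub_cancel_left] at key
  rw [sum_range_succ]
  refine key.trans ?_
  rw [mul_assoc]
  have e1 : Z l ω ^ 2 ≤ K * |Z l ω| := by
    rw [← sq_abs, sq]
    gcongr
  have : Z l ω ^ 2 + |t (l + 1) - t l| ≤ K * (|Z l ω| + (1 + 2 * R) * l2 μ (Z l)) := by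
    linarith
  gcongr

/-- Increments of the second derivative along the sequence. -/
lemma l2_increment_two_le (h : CorrelationDecay μ Z 𝓕 r K R)
    (hc : 0 ≤ c) (hφ : HeatExpansion c φ₀ φ₁ φ₂) {t : ℕ → ℝ}
    (ht : ∀ l, t l = K ^ 2 + tailVar μ Z n l) {l : ℕ} (hl : l < n) (hw : K ^ 2 ≤ w l)
    (hw0 : w l ≤ t l) (hw1 : w l ≤ t (l + 1)) :
    l2 μ (fun ω => φ₂ (t (l + 1)) (∑ i ∈ range (l + 1), Z i ω)
      - φ₂ (t l) (∑ i ∈ range l, Z i ω)) ≤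
      2 * (c / w l) * (1 + (1 + 2 * R)) * l2 μ (Z l) := by
  have hK := h.K_pos
  have hR := h.R_nonneg
  have hwpos : 0 < w l := lt_of_lt_of_le (by positivity) hw
  refine l2_le_of_abs_le_add (h.memLp_two l) (by positivity) (by positivity) ?_
  refine ae_of_all _ fun ω => ?_
  have key := hφ.taylor₂ K (w l) (t l) (t (l + 1)) (∑ i ∈ range l, Z i ω)
    (∑ i ∈ range (l + 1), Z i ω) hK hw hw0 hw1
  have hsig : |t (l + 1) - t l| ≤ (1 + 2 * R) * K * l2 μ (Z l) := by
    rw [ht, ht, add_sub_add_left_eq_sub]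
    exact h.abs_tailVar_sub_le hl
  rw [sum_range_succ, add_sub_cancel_left] at key
  rw [sum_range_succ]
  refine key.trans ?_
  have : |t (l + 1) - t l| / K ≤ (1 + 2 * R) * l2 μ (Z l) := by
    rw [div_le_iff₀ hK]
    linarith
  gcongr

/-- Covariance of a function of the past with a product, using the larger of the two gaps. -/
lemma abs_cov_mul_le (h : CorrelationDecay μ Z 𝓕 r K R)
    {m l i : ℕ} (hml : m < l) (hli : l ≤ i) {F : Ω → ℝ}
    (hF : Measurable[𝓕 (m + 1)] F) (hFb : MemLp F ∞ μ) :
    |cov[F, fun ω => Z l ω * Z i ω; μ]| ≤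
      2 * r (max (l - m) (i - l)) * K * (l2 μ F * l2 μ (Z i)) := by
  have hK := h.K_pos
  have hF2 := memLp_two_of_top hFb
  have n1 := l2_nonneg (μ := μ) F
  have n2 := l2_nonneg (μ := μ) (Z i)
  -- If the gap before l dominates, F is decorrelated from the pair. Otherwise F Z_l belongs to the
  -- past of Z_i, and E(F Z_l Z_i) and E F · E(Z_l Z_i) are small separately, whence the factor 2.
  rcases le_total (i - l) (l - m) with hle | hle
  · rw [max_eq_left hle]
    have hr := h.r_nonneg (l - m)
    calc _ ≤ r (l - m) * (l2 μ F * l2 μ (fun ω => Z l ω * Z i ω)) :=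
          h.cov_two m l i F hml hli hF hF2
      _ ≤ r (l - m) * (l2 μ F * (K * l2 μ (Z i))) := by
          gcongr
          exact h.l2_mul_le' (h.memLp_two i) l
      _ = r (l - m) * K * (l2 μ F * l2 μ (Z i)) := by ring
      _ ≤ 2 * (r (l - m) * K * (l2 μ F * l2 μ (Z i))) := by
          have : 0 ≤ r (l - m) * K * (l2 μ F * l2 μ (Z i)) := by positivity
          linarith
      _ = _ := by ring
  · rw [max_eq_right hle]
    have hr := h.r_nonneg (i - l)
    have hlt : l < i := by omega
    have hFZ : MemLp (fun ω => F ω * Z l ω) ∞ μ := memLp_top_mul hFb (h.memLp_top l)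
    have hFZm : Measurable[𝓕 (l + 1)] (fun ω => F ω * Z l ω) :=
      Measurable.mul (hF.mono (𝓕.mono (by omega)) le_rfl) (h.meas l)
    have e1 := h.cov_one l i _ hlt hFZm (memLp_two_of_top hFZ)
    rw [h.cov_one_eq (memLp_two_of_top hFZ)] at e1
    have e2 : |(∫ ω, F ω ∂μ) * ∫ ω, Z l ω * Z i ω ∂μ| ≤
        r (i - l) * K * (l2 μ F * l2 μ (Z i)) := by
      rw [abs_mul]
      calc _ ≤ l2 μ F * (r (i - l) * (l2 μ (Z l) * l2 μ (Z i))) :=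
            mul_le_mul (abs_integral_le_l2 hF2) (h.abs_integral_mul_le hlt) (abs_nonneg _) n1
        _ ≤ l2 μ F * (r (i - l) * (K * l2 μ (Z i))) := by
            have := h.l2_le l
            gcongr
        _ = _ := by ring
    have e3 : |∫ ω, F ω * Z l ω * Z i ω ∂μ| ≤ r (i - l) * K * (l2 μ F * l2 μ (Z i)) := by
      refine e1.trans ?_
      calc _ ≤ r (i - l) * ((K * l2 μ F) * l2 μ (Z i)) := by
            gcongr
            exact h.l2_mul_le hF2 l
        _ = _ := by ring
    rw [covariance_eq_sub hF2 (memLp_two_of_top (memLp_top_mul (h.memLp_top l) (h.memLp_top i)))]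
    have e4 : ∫ ω, (F * fun ω => Z l ω * Z i ω) ω ∂μ = ∫ ω, F ω * Z l ω * Z i ω ∂μ := by
      congr 1
      ext ω
      simp only [Pi.mul_apply]
      ring
    rw [e4]
    refine (abs_sub _ _).trans ((add_le_add e3 e2).trans (le_of_eq ?_))
    ring

end CorrelationDecay

end Lindeberg

/-! ### Telescoping along the past and the summed Lindeberg estimate. -/

section Lindeberg

open Finset

variable {Ω : Type*} {mΩ : MeasurableSpace Ω} {μ : Measure Ω} [IsProbabilityMeasure μ]
  {Z : ℕ → Ω → ℝ} {𝓕 : Filtration ℕ mΩ} {r : ℕ → ℝ} {K R : ℝ}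
  {c : ℝ} {φ₀ φ₁ φ₂ : ℝ → ℝ → ℝ} {n : ℕ} {w : ℕ → ℝ}

/-- The weights w decrease along the sequence, so each square can be put over the weight of its own
index. This lets the pair interactions be summed one index at a time. -/
lemma mul_div_le_half_add {a b u v : ℝ} (hv : 0 < v) (huv : v ≤ u) :
    a * b / u ≤ (a ^ 2 / u + b ^ 2 / v) / 2 := by
  have hu := hv.trans_le huv
  have h1 : b ^ 2 / u ≤ b ^ 2 / v := by gcongr
  have h2 : a * b / u ≤ (a ^ 2 + b ^ 2) / 2 / u := by
    gcongr
    nlinarith [sq_nonneg (a - b)]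
  have h3 : (a ^ 2 + b ^ 2) / 2 / u = (a ^ 2 / u + b ^ 2 / u) / 2 := by ring
  linarith

namespace CorrelationDecay

/-- Decomposition of the first order term of the Lindeberg method along the past. -/
lemma integral_first_order_eq (h : CorrelationDecay μ Z 𝓕 r K R)
    (hφ : HeatExpansion c φ₀ φ₁ φ₂) (t : ℕ → ℝ) (l k : ℕ) :
    ∫ ω, φ₁ (t k) (∑ i ∈ range k, Z i ω) * Z l ω ∂μ =
      ∑ m ∈ range k, (∫ ω, φ₂ (t m) (∑ i ∈ range m, Z i ω) * (Z m ω * Z l ω) ∂μ +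
        ∫ ω, (φ₁ (t (m + 1)) (∑ i ∈ range (m + 1), Z i ω) - φ₁ (t m) (∑ i ∈ range m, Z i ω)
          - φ₂ (t m) (∑ i ∈ range m, Z i ω) * Z m ω) * Z l ω ∂μ) := by
  obtain ⟨M, hM⟩ := hφ.bdd
  have m1 := fun k => memLp_top_mul
    (h.memLp_comp_partialSum (hφ.cont (t k)).2.1 (fun x => (hM (t k) x).2.1) k) (h.memLp_top l)
  have m2 := fun k => memLp_top_mul
    (h.memLp_comp_partialSum (hφ.cont (t k)).2.2 (fun x => (hM (t k) x).2.2) k)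
    (memLp_top_mul (h.memLp_top k) (h.memLp_top l))
  have i1 := fun k => integrable_of_memLp_top (m1 k)
  have i2 := fun k => integrable_of_memLp_top (m2 k)
  induction k with
  -- The telescoping starts from a constant, which is killed by the centering of Z l.
  | zero => simp [integral_const_mul, h.cent l]
  | succ k ih =>
    rw [sum_range_succ, ← ih]
    have e : (fun ω => (φ₁ (t (k + 1)) (∑ i ∈ range (k + 1), Z i ω)
        - φ₁ (t k) (∑ i ∈ range k, Z i ω)
        - φ₂ (t k) (∑ i ∈ range k, Z i ω) * Z k ω) * Z l ω) = fun ω =>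
        φ₁ (t (k + 1)) (∑ i ∈ range (k + 1), Z i ω) * Z l ω
        - φ₁ (t k) (∑ i ∈ range k, Z i ω) * Z l ω
        - φ₂ (t k) (∑ i ∈ range k, Z i ω) * (Z k ω * Z l ω) := by
      ext ω
      ring
    have i12 : Integrable (fun ω => φ₁ (t (k + 1)) (∑ i ∈ range (k + 1), Z i ω) * Z l ω
        - φ₁ (t k) (∑ i ∈ range k, Z i ω) * Z l ω) μ := (i1 (k + 1)).sub (i1 k)
    rw [e, integral_sub i12 (i2 k), integral_sub (i1 (k + 1)) (i1 k)]
    ring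

/-- Decomposition of the second order term of the Lindeberg method along the past. -/
lemma cov_second_order_eq (h : CorrelationDecay μ Z 𝓕 r K R)
    (hφ : HeatExpansion c φ₀ φ₁ φ₂) (t : ℕ → ℝ) {Y : Ω → ℝ} (hY : MemLp Y ∞ μ) (k : ℕ) :
    cov[fun ω => φ₂ (t k) (∑ i ∈ range k, Z i ω), Y; μ] =
      ∑ m ∈ range k, cov[fun ω => φ₂ (t (m + 1)) (∑ i ∈ range (m + 1), Z i ω)
        - φ₂ (t m) (∑ i ∈ range m, Z i ω), Y; μ] := by
  obtain ⟨M, hM⟩ := hφ.bdd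
  have m2 := fun k => memLp_two_of_top
    (h.memLp_comp_partialSum (hφ.cont (t k)).2.2 (fun x => (hM (t k) x).2.2) k)
  induction k with
  | zero => simp [covariance_const_left]
  | succ k ih =>
    rw [sum_range_succ, ← ih,
      covariance_fun_sub_left (m2 (k + 1)) (m2 k) (memLp_two_of_top hY)]
    ring

/-- The Lindeberg estimate. -/
theorem abs_integral_sub_le (h : CorrelationDecay μ Z 𝓕 r K R) (hc : 0 ≤ c)
    (hφ : HeatExpansion c φ₀ φ₁ φ₂) (hwa : Antitone w) (hw : ∀ l, K ^ 2 ≤ w l)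
    (hw0 : ∀ l, l < n → w l ≤ K ^ 2 + tailVar μ Z n l)
    (hw1 : ∀ l, l < n → w l ≤ K ^ 2 + tailVar μ Z n (l + 1)) :
    |∫ ω, φ₀ (K ^ 2) (∑ i ∈ range n, Z i ω) ∂μ - φ₀ (K ^ 2 + tailVar μ Z n 0) 0| ≤
      c * K * ((2 + 2 * R) ^ 2 + 14 * (2 + 2 * R) * R) *
        ∑ l ∈ range n, (∫ ω, Z l ω ^ 2 ∂μ) / w l := by
  obtain ⟨M, hM⟩ := hφ.bdd
  have hK := h.K_pos
  have hR := h.R_nonneg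
  have hwpos : ∀ l, 0 < w l := fun l => lt_of_lt_of_le (by positivity) (hw l)
  obtain ⟨t, ht⟩ : ∃ t : ℕ → ℝ, ∀ l, t l = K ^ 2 + tailVar μ Z n l := ⟨_, fun l => rfl⟩
  have ht0 : ∀ l, l < n → w l ≤ t l := fun l hl => by rw [ht]; exact hw0 l hl
  have ht1 : ∀ l, l < n → w l ≤ t (l + 1) := fun l hl => by rw [ht]; exact hw1 l hl
  set b : ℕ → ℝ := fun l => l2 μ (Z l) with hb
  have hb0 : ∀ l, 0 ≤ b l := fun l => l2_nonneg _
  set y : ℕ → ℝ := fun l => b l ^ 2 / w l with hy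
  have hy0 : ∀ l, 0 ≤ y l := fun l => div_nonneg (sq_nonneg _) (hwpos l).le
  have hby : ∀ m i, m ≤ i → b m * b i / w m ≤ (y m + y i) / 2 := fun m i hmi =>
    mul_div_le_half_add (hwpos i) (hwa hmi)
  set P₀ : ℕ → Ω → ℝ := fun l ω => φ₀ (t l) (∑ i ∈ range l, Z i ω) with hP₀
  set P₁ : ℕ → Ω → ℝ := fun l ω => φ₁ (t l) (∑ i ∈ range l, Z i ω) with hP₁
  set P₂ : ℕ → Ω → ℝ := fun l ω => φ₂ (t l) (∑ i ∈ range l, Z i ω) with hP₂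
  have mP₁ : ∀ l, MemLp (P₁ l) ∞ μ := fun l =>
    h.memLp_comp_partialSum (hφ.cont (t l)).2.1 (fun x => (hM (t l) x).2.1) l
  have mP₂ : ∀ l, MemLp (P₂ l) ∞ μ := fun l =>
    h.memLp_comp_partialSum (hφ.cont (t l)).2.2 (fun x => (hM (t l) x).2.2) l
  have aP₁ : ∀ l, Measurable[𝓕 l] (P₁ l) := fun l =>
    h.measurable_comp_partialSum (hφ.cont (t l)).2.1 l
  have aP₂ : ∀ l, Measurable[𝓕 l] (P₂ l) := fun l =>
    h.measurable_comp_partialSum (hφ.cont (t l)).2.2 l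
  have mZZ : ∀ l i, MemLp (fun ω => Z l ω * Z i ω) ∞ μ := fun l i =>
    memLp_top_mul (h.memLp_top l) (h.memLp_top i)
  -- The part of the increment of φ₁ beyond its linear term; it is measurable at time m + 1, hence
  -- decorrelated from a later Z l.
  set ψ : ℕ → Ω → ℝ := fun m ω => P₁ (m + 1) ω - P₁ m ω - P₂ m ω * Z m ω with hψ
  set E : ℕ → ℕ → ℝ := fun m l => ∫ ω, ψ m ω * Z l ω ∂μ with hE
  set Q : ℕ → ℕ → ℝ := fun l i => cov[P₂ l, fun ω => Z l ω * Z i ω; μ] with hQ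
  have hQeq : ∀ l i, Q l i = ∫ ω, P₂ l ω * (Z l ω * Z i ω) ∂μ -
      (∫ ω, P₂ l ω ∂μ) * ∫ ω, Z l ω * Z i ω ∂μ := fun l i =>
    covariance_eq_sub (memLp_two_of_top (mP₂ l)) (memLp_two_of_top (mZZ l i))
  set main : ℕ → ℝ := fun l => ∫ ω, P₁ l ω * Z l ω ∂μ
    + (∫ ω, P₂ l ω * (Z l ω * Z l ω) ∂μ) / 2 - (t l - t (l + 1)) / 2 * ∫ ω, P₂ l ω ∂μ with hmain
  -- the remainder terms of the expansion
  have hstep : |∑ l ∈ range n, ((∫ ω, P₀ (l + 1) ω ∂μ - ∫ ω, P₀ l ω ∂μ) - main l)| ≤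
      c * K * (2 + 2 * R) ^ 2 * ∑ l ∈ range n, y l := by
    rw [mul_sum]
    refine (abs_sum_le_sum_abs _ _).trans (sum_le_sum fun l hl => ?_)
    have hl := mem_range.1 hl
    have := h.abs_step_le hc hφ ht hl (hw l) (ht0 l hl) (ht1 l hl)
    refine this.trans (le_of_eq ?_)
    rw [← add_assoc, one_add_one_eq_two]
  have hEle : ∀ l, l < n → ∀ m ∈ range l, |E m l| ≤
      2 * c * K * (2 + 2 * R) * (r (l - m) * ((y m + y l) / 2)) := by
    intro l hl m hm
    have hm := mem_range.1 hm
    have hψm : Measurable[𝓕 (m + 1)] (ψ m) :=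
      ((aP₁ (m + 1)).sub ((aP₁ m).mono (𝓕.mono (Nat.le_succ m)) le_rfl)).sub
        (((aP₂ m).mono (𝓕.mono (Nat.le_succ m)) le_rfl).mul (h.meas m))
    have hψb : MemLp (ψ m) 2 μ := memLp_two_of_top
      (((mP₁ (m + 1)).sub (mP₁ m)).sub (memLp_top_mul (mP₂ m) (h.memLp_top m)))
    have h1 := h.cov_one m l (ψ m) hm hψm hψb
    rw [h.cov_one_eq hψb] at h1
    have h2 : l2 μ (ψ m) ≤ 2 * (c / w m * K) * (1 + (1 + 2 * R)) * b m :=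
      h.l2_increment_one_le hc hφ ht (hm.trans hl) (hw m) (ht0 m (hm.trans hl))
        (ht1 m (hm.trans hl))
    have hr := h.r_nonneg (l - m)
    calc |E m l| ≤ r (l - m) * (l2 μ (ψ m) * b l) := h1
      _ ≤ r (l - m) * (2 * (c / w m * K) * (1 + (1 + 2 * R)) * b m * b l) := by
          have := hb0 l
          gcongr
      _ = 2 * c * K * (2 + 2 * R) * (r (l - m) * (b m * b l / w m)) := by ring
      _ ≤ _ := by
          have := hby m l hm.le
          gcongr
  have hQle : ∀ l, l < n → ∀ i, l ≤ i → |Q l i| ≤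
      4 * c * K * (2 + 2 * R) * ∑ m ∈ range l, r (max (l - m) (i - l)) * ((y m + y i) / 2) := by
    intro l hl i hli
    have e := h.cov_second_order_eq hφ t (mZZ l i) l
    rw [mul_sum]
    calc |Q l i| ≤ ∑ m ∈ range l, |cov[fun ω => P₂ (m + 1) ω - P₂ m ω,
            fun ω => Z l ω * Z i ω; μ]| := by
          rw [hQ]
          simp only
          rw [e]
          exact abs_sum_le_sum_abs _ _
      _ ≤ _ := by
          refine sum_le_sum fun m hm => ?_
          have hm := mem_range.1 hm
          have hΔm : Measurable[𝓕 (m + 1)] (fun ω => P₂ (m + 1) ω - P₂ m ω) :=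
            (aP₂ (m + 1)).sub ((aP₂ m).mono (𝓕.mono (Nat.le_succ m)) le_rfl)
          have hΔb : MemLp (fun ω => P₂ (m + 1) ω - P₂ m ω) ∞ μ := (mP₂ (m + 1)).sub (mP₂ m)
          have h1 := h.abs_cov_mul_le hm hli hΔm hΔb
          have h2 : l2 μ (fun ω => P₂ (m + 1) ω - P₂ m ω) ≤
              2 * (c / w m) * (1 + (1 + 2 * R)) * b m :=
            h.l2_increment_two_le hc hφ ht (hm.trans hl) (hw m) (ht0 m (hm.trans hl))
              (ht1 m (hm.trans hl))
          have hr := h.r_nonneg (max (l - m) (i - l))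
          calc _ ≤ _ := h1
            _ ≤ 2 * r (max (l - m) (i - l)) * K *
                (2 * (c / w m) * (1 + (1 + 2 * R)) * b m * b i) := by
              have := hb0 i
              gcongr
            _ = 4 * c * K * (2 + 2 * R) * (r (max (l - m) (i - l)) * (b m * b i / w m)) := by
              ring
            _ ≤ _ := by
              have := hby m i (hm.le.trans hli)
              gcongr
  -- the main terms reorganize into covariances
  have hmainsum : ∑ l ∈ range n, main l = ∑ l ∈ range n, ∑ m ∈ range l, E m l +
      ∑ l ∈ range n, (Q l l / 2 + ∑ i ∈ Ico (l + 1) n, Q l i) := by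
    have e1 : ∀ l ∈ range n, main l =
        ∑ m ∈ range l, E m l + ∑ m ∈ range l, ∫ ω, P₂ m ω * (Z m ω * Z l ω) ∂μ
          + (Q l l / 2 - ∑ i ∈ Ico (l + 1) n, (∫ ω, P₂ l ω ∂μ) * ∫ ω, Z l ω * Z i ω ∂μ) := by
      intro l hl
      have hl := mem_range.1 hl
      have f1 : ∫ ω, P₁ l ω * Z l ω ∂μ =
          ∑ m ∈ range l, (∫ ω, P₂ m ω * (Z m ω * Z l ω) ∂μ + E m l) :=
        h.integral_first_order_eq hφ t l l
      have f2 : t l - t (l + 1) = (∫ ω, Z l ω * Z l ω ∂μ) +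
          2 * ∑ i ∈ Ico (l + 1) n, ∫ ω, Z l ω * Z i ω ∂μ := by
        rw [ht, ht, add_sub_add_left_eq_sub, h.tailVar_sub hl]
        simp_rw [sq]
      rw [hmain]
      simp only
      rw [f1, f2, sum_add_distrib, hQeq, ← mul_sum]
      ring
    -- After the exchange, the products of Z m with its future meet the terms E P₂ · E(Z Z) coming
    -- from t m - t (m + 1), and together they form covariances.
    have e2 : ∑ l ∈ range n, ∑ m ∈ range l, ∫ ω, P₂ m ω * (Z m ω * Z l ω) ∂μ =
        ∑ m ∈ range n, ∑ l ∈ Ico (m + 1) n, ∫ ω, P₂ m ω * (Z m ω * Z l ω) ∂μ := by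
      refine sum_comm' fun l m => ?_
      simp only [mem_range, mem_Ico]
      omega
    rw [sum_congr rfl e1, sum_add_distrib, sum_add_distrib, e2, add_assoc, ← sum_add_distrib]
    congr 1
    refine sum_congr rfl fun l _ => ?_
    simp_rw [hQeq l, sum_sub_distrib]
    ring
  have hEsum : |∑ l ∈ range n, ∑ m ∈ range l, E m l| ≤
      2 * c * K * (2 + 2 * R) * (R * ∑ l ∈ range n, y l) := by
    calc _ ≤ ∑ l ∈ range n, ∑ m ∈ range l,
            2 * c * K * (2 + 2 * R) * (r (l - m) * ((y m + y l) / 2)) :=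
          (abs_sum_le_sum_abs _ _).trans (sum_le_sum fun l hl =>
            (abs_sum_le_sum_abs _ _).trans (sum_le_sum (hEle l (mem_range.1 hl))))
      _ = 2 * c * K * (2 + 2 * R) *
            ∑ l ∈ range n, ∑ m ∈ range l, r (l - m) * ((y m + y l) / 2) := by
          simp_rw [mul_sum]
      _ ≤ _ := by
          have := sum_pair_le h.r_nonneg h.r_zero hy0 h.sum_le n
          gcongr
  have hQsum : |∑ l ∈ range n, (Q l l / 2 + ∑ i ∈ Ico (l + 1) n, Q l i)| ≤
      4 * c * K * (2 + 2 * R) * (3 * R * ∑ l ∈ range n, y l) := by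
    calc _ ≤ ∑ l ∈ range n, ∑ i ∈ Ico l n, |Q l i| := by
          refine (abs_sum_le_sum_abs _ _).trans (sum_le_sum fun l hl => ?_)
          rw [sum_eq_sum_Ico_succ_bot (mem_range.1 hl)]
          refine (abs_add_le _ _).trans (add_le_add ?_ (abs_sum_le_sum_abs _ _))
          rw [abs_div, abs_two]
          exact half_le_self (abs_nonneg _)
      _ ≤ ∑ l ∈ range n, ∑ i ∈ Ico l n, 4 * c * K * (2 + 2 * R) *
            ∑ m ∈ range l, r (max (l - m) (i - l)) * ((y m + y i) / 2) :=
          sum_le_sum fun l hl => sum_le_sum fun i hi =>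
            hQle l (mem_range.1 hl) i (mem_Ico.1 hi).1
      _ = 4 * c * K * (2 + 2 * R) * ∑ l ∈ range n, ∑ i ∈ Ico l n,
            ∑ m ∈ range l, r (max (l - m) (i - l)) * ((y m + y i) / 2) := by
          simp_rw [mul_sum]
      _ ≤ _ := by
          have := sum_triple_le h.r_nonneg h.r_zero hy0 h.sum_le n
          gcongr
  have htn : t n = K ^ 2 := by simp [ht, tailVar]
  have htel : ∫ ω, φ₀ (K ^ 2) (∑ i ∈ range n, Z i ω) ∂μ - φ₀ (K ^ 2 + tailVar μ Z n 0) 0 =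
      ∑ l ∈ range n, ((∫ ω, P₀ (l + 1) ω ∂μ - ∫ ω, P₀ l ω ∂μ) - main l)
        + ∑ l ∈ range n, main l := by
    rw [← sum_add_distrib]
    simp only [sub_add_cancel]
    rw [sum_range_sub (fun l => ∫ ω, P₀ l ω ∂μ), hP₀]
    simp [htn, ht]
  have hyeq : ∑ l ∈ range n, (∫ ω, Z l ω ^ 2 ∂μ) / w l = ∑ l ∈ range n, y l :=
    sum_congr rfl fun l _ => by rw [hy, hb]; simp only [l2_sq]
  rw [htel, hmainsum, hyeq]
  -- The constant 14 is 2 from `hEsum` plus 4 · 3 from `hQsum`.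
  refine (abs_add_le _ _).trans ((add_le_add hstep ((abs_add_le _ _).trans
    (add_le_add hEsum hQsum))).trans (le_of_eq ?_))
  ring

end CorrelationDecay

end Lindeberg

/-! ### From the coefficients ρ(k) and C_n to the abstract decay hypotheses. -/

section Mixing

open Finset

lemma abs_cov_le_of_maxCorr_le {Ω : Type*} {U V : MeasurableSpace Ω} [MeasurableSpace Ω]
    {μ : Measure Ω} [IsProbabilityMeasure μ] {ρ : ℝ} (hρ0 : 0 ≤ ρ)
    (hρ : maxCorr U V μ ≤ ENNReal.ofReal ρ) {f g : Ω → ℝ} (hf : Measurable[U] f)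
    (hf2 : MemLp f 2 μ) (hg : Measurable[V] g) (hg2 : MemLp g 2 μ) :
    |cov[f, g; μ]| ≤ ρ * (l2 μ f * l2 μ g) := by
  have hcorr : |corr f g μ| ≤ ρ := by
    rw [← ENNReal.ofReal_le_ofReal_iff hρ0]
    refine le_trans ?_ hρ
    unfold maxCorr
    exact le_iSup_of_le f <| le_iSup_of_le g <| le_iSup₂_of_le ⟨hf, hf2⟩ ⟨hg, hg2⟩ le_rfl
  have hstd : ∀ {F : Ω → ℝ}, MemLp F 2 μ → l2 μ (fun ω => F ω - μ[F]) = √(Var[F; μ]) :=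
    fun hF => by rw [l2, variance_eq_integral hF.aestronglyMeasurable.aemeasurable]
  have hle : ∀ {F : Ω → ℝ}, MemLp F 2 μ → √(Var[F; μ]) ≤ l2 μ F := fun hF =>
    Real.sqrt_le_sqrt (variance_le_expectation_sq hF.aestronglyMeasurable)
  have hcs : |cov[f, g; μ]| ≤ √(Var[f; μ]) * √(Var[g; μ]) := by
    rw [← hstd hf2, ← hstd hg2]
    exact abs_integral_mul_le_l2 (hf2.sub (memLp_const _)) (hg2.sub (memLp_const _))
  have hd0 : 0 ≤ √(Var[f; μ]) * √(Var[g; μ]) := by positivity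
  have hbound : |cov[f, g; μ]| ≤ ρ * (√(Var[f; μ]) * √(Var[g; μ])) := by
    -- If a variance vanishes, `corr` is 0 by convention and carries no information; Cauchy–Schwarz
    -- then gives zero covariance.
    rcases hd0.eq_or_lt with h0 | hpos
    · rw [← h0] at hcs ⊢
      rwa [mul_zero]
    · rwa [corr, abs_div, abs_of_pos hpos, div_le_iff₀ hpos] at hcorr
  refine hbound.trans (mul_le_mul_of_nonneg_left ?_ hρ0)
  exact mul_le_mul (hle hf2) (hle hg2) (Real.sqrt_nonneg _) (l2_nonneg _)

lemma measurable_sigmaGen {Ω : Type*} {X : ℕ → Ω → ℝ} {A : Set ℕ} {i : ℕ} (hi : i ∈ A) :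
    Measurable[sigmaGen X A] (X i) :=
  measurable_iff_comap_le.2 (le_iSup₂_of_le i hi le_rfl)

/-- The first `n` variables `X 1, …, X n`, followed by zeros. -/
def truncSeq {Ω : Type*} (X : ℕ → Ω → ℝ) (n i : ℕ) (ω : Ω) : ℝ := if i < n then X (i + 1) ω else 0

lemma truncSeq_of_lt {Ω : Type*} {X : ℕ → Ω → ℝ} {n i : ℕ} (h : i < n) : truncSeq X n i = X (i + 1) := by
  ext ω
  simp [truncSeq, h]

lemma truncSeq_of_le {Ω : Type*} {X : ℕ → Ω → ℝ} {n i : ℕ} (h : n ≤ i) : truncSeq X n i = fun _ => 0 := by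
  ext ω
  simp [truncSeq, not_lt.2 h]

variable {Ω : Type*} [mΩ : MeasurableSpace Ω] {μ : Measure Ω} [IsProbabilityMeasure μ]

/-- The filtration of the past `σ(X 1, …, X j)`. -/
def pastFiltration (X : ℕ → Ω → ℝ) (hmeas : ∀ i, 1 ≤ i → Measurable (X i)) : Filtration ℕ mΩ where
  seq j := sigmaGen X (Set.Icc 1 j)
  mono' _ _ hij := biSup_mono fun _ hk => ⟨hk.1, hk.2.trans hij⟩
  le' _ := iSup₂_le fun k hk => (hmeas k hk.1).comap_le

/-- The real valued mixing coefficient, set to `0` at lag `0`. -/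
noncomputable def rhoReal (X : ℕ → Ω → ℝ) (μ : Measure Ω) (k : ℕ) : ℝ :=
  if k = 0 then 0 else (rho X μ k).toReal

lemma sum_mul_rhoReal_le {X : ℕ → Ω → ℝ} (hH1 : ∑' k : ℕ, (k : ℝ≥0∞) * rho X μ k < ∞) (N : ℕ) :
    ∑ k ∈ range N, k * rhoReal X μ k ≤ (∑' k : ℕ, (k : ℝ≥0∞) * rho X μ k).toReal := by
  have e : ∀ k ∈ range N, (k : ℝ) * rhoReal X μ k = ((k : ℝ≥0∞) * rho X μ k).toReal := by
    intro k _
    rcases eq_or_ne k 0 with rfl | hk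
    · simp [rhoReal]
    · simp [rhoReal, hk]
  rw [sum_congr rfl e, ← ENNReal.toReal_sum fun k _ => ENNReal.ne_top_of_tsum_ne_top hH1.ne k]
  exact ENNReal.toReal_mono hH1.ne (ENNReal.sum_le_tsum _)

lemma maxSupNorm_lt_top {X : ℕ → Ω → ℝ} (hbdd : ∀ i, 1 ≤ i → MemLp (X i) ∞ μ) (n : ℕ) :
    maxSupNorm X μ n < ∞ :=
  (Finset.sup_lt_iff (by simp)).2 fun i hi => (hbdd i (mem_Icc.1 hi).1).2

lemma ae_abs_le_maxSupNorm {X : ℕ → Ω → ℝ} (hbdd : ∀ i, 1 ≤ i → MemLp (X i) ∞ μ) {n i : ℕ}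
    (hi : i ∈ Icc 1 n) : ∀ᵐ ω ∂μ, |X i ω| ≤ (maxSupNorm X μ n).toReal := by
  have h1 : eLpNorm (X i) ∞ μ ≤ maxSupNorm X μ n :=
    Finset.le_sup (f := fun i => eLpNorm (X i) ∞ μ) hi
  rw [eLpNorm_exponent_top] at h1
  filter_upwards [ae_le_eLpNormEssSup (f := X i) (μ := μ)] with ω hω
  have := ENNReal.toReal_mono (maxSupNorm_lt_top hbdd n).ne (hω.trans h1)
  simpa using this

/-- Replacing the variables after time n by zeros makes the bound K_n valid at every index. Since Z
m is X (m + 1), the past of m is generated up to time m + 1, and the lag to X (l + 1) is l - m. -/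
lemma correlationDecay_truncSeq {X : ℕ → Ω → ℝ} (hmeas : ∀ i, 1 ≤ i → Measurable (X i))
    (hbdd : ∀ i, 1 ≤ i → MemLp (X i) ∞ μ) (hcent : ∀ i, 1 ≤ i → ∫ ω, X i ω ∂μ = 0)
    (hH1 : ∑' k : ℕ, (k : ℝ≥0∞) * rho X μ k < ∞) (n : ℕ)
    (hK : 0 < (maxSupNorm X μ n).toReal) :
    CorrelationDecay μ (truncSeq X n) (pastFiltration X hmeas) (rhoReal X μ)
      (maxSupNorm X μ n).toReal (∑' k : ℕ, (k : ℝ≥0∞) * rho X μ k).toReal := by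
  have hr0 : ∀ k, 0 ≤ rhoReal X μ k := fun k => by
    unfold rhoReal
    split_ifs <;> simp
  have hrho : ∀ {m l v : ℕ}, m < l → l + 1 < v →
      maxCorr (sigmaGen X (Set.Icc 1 (m + 1))) (sigmaGen X {l + 1, v}) μ ≤
        ENNReal.ofReal (rhoReal X μ (l - m)) := by
    intro m l v hml hv
    have hne : l - m ≠ 0 := by omega
    have hfin : rho X μ (l - m) ≠ ∞ := by
      have := ENNReal.ne_top_of_tsum_ne_top hH1.ne (l - m)
      intro htop
      rw [htop, ENNReal.mul_top (by exact_mod_cast hne)] at this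
      exact this rfl
    rw [rhoReal, if_neg hne, ENNReal.ofReal_toReal hfin]
    exact le_iSup₂_of_le (m + 1) (by omega) <| le_iSup_of_le (l + 1) <| le_iSup_of_le v <|
      le_iSup_of_le ⟨by omega, hv⟩ le_rfl
  have hX2 : ∀ i, MemLp (X (i + 1)) 2 μ := fun i => memLp_two_of_top (hbdd _ (by omega))
  constructor
  · intro i
    by_cases hi : i < n
    · rw [truncSeq_of_lt hi]
      exact measurable_sigmaGen ⟨by omega, le_rfl⟩
    · rw [truncSeq_of_le (not_lt.1 hi)]
      exact measurable_const
  · intro i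
    by_cases hi : i < n
    · rw [truncSeq_of_lt hi]
      exact ae_abs_le_maxSupNorm hbdd (mem_Icc.2 ⟨by omega, by omega⟩)
    · rw [truncSeq_of_le (not_lt.1 hi)]
      simp
  · intro i
    by_cases hi : i < n
    · rw [truncSeq_of_lt hi]
      exact hcent _ (by omega)
    · rw [truncSeq_of_le (not_lt.1 hi)]
      simp
  · intro m l F hml hF hF2
    by_cases hl : l < n
    · rw [truncSeq_of_lt hl]
      -- The coefficient always involves two future instants; l + 2 is a dummy second one.
      exact abs_cov_le_of_maxCorr_le (hr0 _) (hrho hml (Nat.lt_succ_self (l + 1))) hF hF2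
        (measurable_sigmaGen (Set.mem_insert _ _)) (hX2 l)
    · rw [truncSeq_of_le (not_lt.1 hl), covariance_const_right, abs_zero]
      exact mul_nonneg (hr0 _) (mul_nonneg (l2_nonneg _) (l2_nonneg _))
  · intro m l i F hml hli hF hF2
    by_cases hi : i < n
    · rw [truncSeq_of_lt hi, truncSeq_of_lt (hli.trans_lt hi)]
      have hZ2 : MemLp (fun ω => X (l + 1) ω * X (i + 1) ω) 2 μ :=
        memLp_two_of_top (memLp_top_mul (hbdd _ (by omega)) (hbdd _ (by omega)))
      rcases hli.eq_or_lt with rfl | hlt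
      · exact abs_cov_le_of_maxCorr_le (hr0 _) (hrho hml (Nat.lt_succ_self (l + 1))) hF hF2
          (Measurable.mul (measurable_sigmaGen (Set.mem_insert _ _))
            (measurable_sigmaGen (Set.mem_insert _ _))) hZ2
      · exact abs_cov_le_of_maxCorr_le (hr0 _) (hrho (v := i + 1) hml (by omega)) hF hF2
          (Measurable.mul (measurable_sigmaGen (Set.mem_insert _ _))
            (measurable_sigmaGen (Set.mem_insert_of_mem _ rfl))) hZ2
    · rw [truncSeq_of_le (not_lt.1 hi)]
      simp only [mul_zero]
      rw [covariance_const_right, abs_zero]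
      exact mul_nonneg (hr0 _) (mul_nonneg (l2_nonneg _) (l2_nonneg _))
  · exact hr0
  · simp [rhoReal]
  · exact sum_mul_rhoReal_le hH1
  · exact hK

lemma sum_Ico_truncSeq (X : ℕ → Ω → ℝ) {n l : ℕ} (hl : l ≤ n) (ω : Ω) :
    ∑ i ∈ Ico l n, truncSeq X n i ω = S X n ω - S X l ω := by
  have hS : ∀ k, S X k ω = ∑ i ∈ range k, X (i + 1) ω := fun k => by
    rw [S, range_eq_Ico, sum_Ico_add' (fun i => X i ω) 0 k 1]
    rfl
  rw [hS, hS, ← sum_Ico_eq_sub _ hl]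
  refine sum_congr rfl fun i hi => ?_
  rw [truncSeq_of_lt (mem_Ico.1 hi).2]

lemma sum_sq_le_varRatio_mul {X : ℕ → Ω → ℝ} {n l : ℕ} (hl : l < n)
    (hfin : varRatio X μ n < ∞) :
    ∑ i ∈ Ico l n, ∫ ω, truncSeq X n i ω ^ 2 ∂μ ≤
      (varRatio X μ n).toReal * tailVar μ (truncSeq X n) n l := by
  have h1 : ENNReal.ofReal (∑ i ∈ Icc (l + 1) n, ∫ ω, X i ω ^ 2 ∂μ) /
      ENNReal.ofReal (∫ ω, (S X n ω - S X l ω) ^ 2 ∂μ) ≤ varRatio X μ n :=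
    Finset.le_sup (f := fun ℓ => ENNReal.ofReal (∑ i ∈ Finset.Icc ℓ n, ∫ ω, X i ω ^ 2 ∂μ) /
      ENNReal.ofReal (∫ ω, (S X n ω - S X (ℓ - 1) ω) ^ 2 ∂μ))
      (mem_Icc.2 ⟨by omega, by omega⟩ : l + 1 ∈ Icc 1 n)
  have e1 : ∑ i ∈ Icc (l + 1) n, ∫ ω, X i ω ^ 2 ∂μ =
      ∑ i ∈ Ico l n, ∫ ω, truncSeq X n i ω ^ 2 ∂μ := by
    have : Icc (l + 1) n = Ico (l + 1) (n + 1) := rfl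
    rw [this, ← sum_Ico_add' (fun i => ∫ ω, X i ω ^ 2 ∂μ) l n 1]
    refine sum_congr rfl fun i hi => ?_
    rw [truncSeq_of_lt (mem_Ico.1 hi).2]
  have e2 : ∫ ω, (S X n ω - S X l ω) ^ 2 ∂μ = tailVar μ (truncSeq X n) n l := by
    rw [tailVar]
    simp_rw [sum_Ico_truncSeq X hl.le]
  rw [e1, e2] at h1
  have hsum0 : 0 ≤ ∑ i ∈ Ico l n, ∫ ω, truncSeq X n i ω ^ 2 ∂μ :=
    sum_nonneg fun i _ => integral_nonneg fun ω => sq_nonneg _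
  have hv0 : 0 ≤ tailVar μ (truncSeq X n) n l := integral_nonneg fun _ => sq_nonneg _
  rcases hv0.eq_or_lt with h0 | hpos
  -- A vanishing tail variance forces a vanishing numerator, since x / 0 = ∞ for x > 0 and C_n is
  -- finite.
  · rw [← h0, ENNReal.ofReal_zero] at h1
    rw [← h0, mul_zero]
    by_contra! hlt
    rw [ENNReal.div_zero (by simpa using hlt)] at h1
    exact absurd (h1.trans_lt hfin) (lt_irrefl _)
  · have h2 := ENNReal.toReal_mono hfin.ne h1
    rwa [ENNReal.toReal_div, ENNReal.toReal_ofReal hsum0, ENNReal.toReal_ofReal hv0,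
      div_le_iff₀ hpos] at h2

/-- At the last index with a nonzero second moment, both the sum of second moments and the tail
variance reduce to that single moment. -/
lemma CorrelationDecay.one_le_of_sum_sq_le {Z : ℕ → Ω → ℝ} {𝓕 : Filtration ℕ mΩ} {r : ℕ → ℝ}
    {K R c : ℝ} {n : ℕ} (h : CorrelationDecay μ Z 𝓕 r K R)
    (hc : ∀ l, l < n → ∑ i ∈ Ico l n, ∫ ω, Z i ω ^ 2 ∂μ ≤ c * tailVar μ Z n l)
    (hne : ∃ i, i < n ∧ 0 < ∫ ω, Z i ω ^ 2 ∂μ) : 1 ≤ c := by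
  classical
  obtain ⟨l, hl, hmax⟩ := ((range n).filter fun i => 0 < ∫ ω, Z i ω ^ 2 ∂μ).exists_max_image id
    (by
      obtain ⟨i, hi, hpos⟩ := hne
      exact ⟨i, mem_filter.2 ⟨mem_range.2 hi, hpos⟩⟩)
  rw [mem_filter, mem_range] at hl
  have hzero : ∀ i ∈ Ico (l + 1) n, ∫ ω, Z i ω ^ 2 ∂μ = 0 := by
    intro i hi
    have hi := mem_Ico.1 hi
    by_contra hne
    have hpos : 0 < ∫ ω, Z i ω ^ 2 ∂μ :=
      lt_of_le_of_ne (integral_nonneg fun _ => sq_nonneg _) (Ne.symm hne)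
    have := hmax i (mem_filter.2 ⟨mem_range.2 hi.2, hpos⟩)
    simp only [id] at this
    omega
  have hae : ∀ i ∈ Ico (l + 1) n, ∀ᵐ ω ∂μ, Z i ω = 0 := by
    intro i hi
    have := (integral_eq_zero_iff_of_nonneg (fun ω => sq_nonneg (Z i ω))
      (h.memLp_two i).integrable_sq).1 (hzero i hi)
    filter_upwards [this] with ω hω
    exact pow_eq_zero_iff two_ne_zero |>.1 hω
  have hv : tailVar μ Z n l = ∫ ω, Z l ω ^ 2 ∂μ := by
    refine integral_congr_ae ?_
    filter_upwards [(ae_ball_iff (Ico (l + 1) n).countable_toSet).2 hae] with ω hω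
    rw [sum_eq_sum_Ico_succ_bot hl.1, sum_eq_zero hω, add_zero]
  have hs := hc l hl.1
  rw [sum_eq_sum_Ico_succ_bot hl.1, sum_eq_zero hzero, add_zero, hv] at hs
  exact le_of_mul_le_mul_right (by rwa [one_mul]) hl.2

end Mixing

/-! ### Logarithmic summation. -/

section Logarithm

open Finset

/-- Summation of a series with its own remainders in the denominator. -/
lemma sum_div_tail_le_log {x : ℕ → ℝ} {κ c : ℝ} (hx : ∀ i, 0 ≤ x i) (hκ : 0 < κ)
    (hxκ : ∀ i, x i ≤ κ) (hc : 1 ≤ c) (n : ℕ) :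
    ∑ l ∈ range n, x l / (κ + (∑ i ∈ Ico (l + 1) n, x i) / c) ≤
      2 * c * Real.log (1 + (∑ i ∈ range n, x i) / κ) := by
  set u : ℕ → ℝ := fun l => κ + ∑ i ∈ Ico l n, x i with hu
  have hT : ∀ l, 0 ≤ ∑ i ∈ Ico l n, x i := fun l => sum_nonneg fun i _ => hx i
  have hupos : ∀ l, 0 < u l := fun l => by
    have := hT l
    simp only [hu]
    linarith
  -- As c ≥ 1, the denominator is at least u (l + 1) / c, and x l ≤ κ gives u l ≤ 2 u (l + 1). The
  -- inequality 1 - 1/y ≤ log y at y = u l / u (l + 1) then makes the bound telescope.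
  have hstep : ∀ l ∈ range n, x l / (κ + (∑ i ∈ Ico (l + 1) n, x i) / c) ≤
      2 * c * (Real.log (u l) - Real.log (u (l + 1))) := by
    intro l hl
    have hc0 : 0 < c := by linarith
    have hul : u l = x l + u (l + 1) := by
      simp only [hu]
      rw [sum_eq_sum_Ico_succ_bot (mem_range.1 hl)]
      ring
    have h2 : u l ≤ 2 * u (l + 1) := by
      have := hT (l + 1)
      have := hxκ l
      have : κ ≤ u (l + 1) := by simp only [hu]; linarith
      linarith
    have h3 : u (l + 1) / c ≤ κ + (∑ i ∈ Ico (l + 1) n, x i) / c := by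
      simp only [hu]
      rw [add_div]
      gcongr
      exact div_le_self hκ.le hc
    have h4 : x l / u l ≤ Real.log (u l) - Real.log (u (l + 1)) := by
      rw [← Real.log_div (hupos l).ne' (hupos (l + 1)).ne']
      refine le_trans (le_of_eq ?_)
        (Real.one_sub_inv_le_log_of_pos (div_pos (hupos l) (hupos (l + 1))))
      rw [inv_div, eq_sub_iff_add_eq, ← add_div, ← hul, div_self (hupos l).ne']
    have hp := hupos (l + 1)
    have hp' := hupos l
    have hxl := hx l
    calc x l / (κ + (∑ i ∈ Ico (l + 1) n, x i) / c) ≤ x l / (u (l + 1) / c) := by gcongr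
      _ ≤ x l / ((u l / 2) / c) := by
          gcongr
          linarith
      _ = 2 * c * (x l / u l) := by field_simp
      _ ≤ _ := by gcongr
  refine (sum_le_sum hstep).trans (le_of_eq ?_)
  rw [← mul_sum, sum_range_sub', ← Real.log_div (hupos 0).ne' (hupos n).ne']
  congr 2
  simp only [hu, Ico_self, sum_empty, add_zero, range_eq_Ico]
  field_simp

/-- Bernoulli's inequality 1 + a y ≤ (1 + y)^a. -/
lemma log_one_add_mul_le {a y : ℝ} (ha : 1 ≤ a) (hy : 0 ≤ y) :
    Real.log (1 + a * y) ≤ a * Real.log (1 + y) := by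
  rw [← Real.log_rpow (by linarith)]
  exact Real.log_le_log (by positivity)
    (one_add_mul_self_le_rpow_one_add (by linarith) ha)

end Logarithm

/-! ### The estimate at smoothing level K_n. -/

section MainEstimate

open Finset

variable {Ω : Type*} [mΩ : MeasurableSpace Ω] {μ : Measure Ω} [IsProbabilityMeasure μ]
  {X : ℕ → Ω → ℝ}

/-- K_n is nondecreasing in n, so its first positive value serves as κ. -/
lemma exists_pos_le_maxSupNorm (hbdd : ∀ i, 1 ≤ i → MemLp (X i) ∞ μ) :
    ∃ κ : ℝ, 0 < κ ∧ ∀ n, 0 < (maxSupNorm X μ n).toReal → κ ≤ (maxSupNorm X μ n).toReal := by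
  classical
  by_cases h : ∃ n, 0 < (maxSupNorm X μ n).toReal
  · refine ⟨_, Nat.find_spec h, fun n hn => ?_⟩
    exact ENNReal.toReal_mono (maxSupNorm_lt_top hbdd n).ne
      (Finset.sup_mono (Icc_subset_Icc le_rfl (Nat.find_min' h hn)))
  · push Not at h
    exact ⟨1, one_pos, fun n hn => absurd (h n) (not_le.2 hn)⟩

lemma ae_eq_zero_of_maxSupNorm_eq_zero (hbdd : ∀ i, 1 ≤ i → MemLp (X i) ∞ μ) {n : ℕ}
    (h : (maxSupNorm X μ n).toReal = 0) : S X n =ᵐ[μ] 0 := by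
  have hX : ∀ i ∈ Icc 1 n, ∀ᵐ ω ∂μ, X i ω = 0 := fun i hi => by
    filter_upwards [ae_abs_le_maxSupNorm hbdd hi] with ω hω
    rw [h] at hω
    exact abs_nonpos_iff.1 hω
  filter_upwards [(ae_ball_iff (Icc 1 n).countable_toSet).2 hX] with ω hω
  exact sum_eq_zero hω

lemma exists_pos_of_maxSupNorm_pos (hmeas : ∀ i, 1 ≤ i → Measurable (X i))
    (hbdd : ∀ i, 1 ≤ i → MemLp (X i) ∞ μ) {n : ℕ}
    (h : 0 < (maxSupNorm X μ n).toReal) :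
    ∃ i, i < n ∧ 0 < ∫ ω, truncSeq X n i ω ^ 2 ∂μ := by
  by_contra! hcon
  have hz : maxSupNorm X μ n = 0 := by
    refine Finset.sup_eq_bot_iff _ _ |>.2 fun i hi => ?_
    obtain ⟨h1, hn⟩ := mem_Icc.1 hi
    have hle := hcon (i - 1) (by omega)
    rw [truncSeq_of_lt (by omega : i - 1 < n), Nat.sub_add_cancel h1] at hle
    have h0 : ∫ ω, X i ω ^ 2 ∂μ = 0 := le_antisymm hle (integral_nonneg fun _ => sq_nonneg _)
    have hae := (integral_eq_zero_iff_of_nonneg (fun ω => sq_nonneg (X i ω))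
      (memLp_two_of_top (hbdd i h1)).integrable_sq).1 h0
    rw [ENNReal.bot_eq_zero, eLpNorm_eq_zero_iff (hmeas i h1).aestronglyMeasurable (by simp)]
    filter_upwards [hae] with ω hω
    exact pow_eq_zero_iff two_ne_zero |>.1 hω
  rw [hz] at h
  simp at h

lemma measurable_partialSum_of_measurable (hmeas : ∀ i, 1 ≤ i → Measurable (X i)) (n : ℕ) :
    Measurable (S X n) :=
  Finset.measurable_fun_sum _ fun i hi => hmeas i (mem_Icc.1 hi).1

lemma sum_range_truncSeq (X : ℕ → Ω → ℝ) (n : ℕ) (ω : Ω) :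
    ∑ i ∈ range n, truncSeq X n i ω = S X n ω := by
  rw [range_eq_Ico, sum_Ico_truncSeq X (Nat.zero_le n)]
  simp [S]

lemma variance_eq_tailVar (hmeas : ∀ i, 1 ≤ i → Measurable (X i))
    (hbdd : ∀ i, 1 ≤ i → MemLp (X i) ∞ μ) (hcent : ∀ i, 1 ≤ i → ∫ ω, X i ω ∂μ = 0) (n : ℕ) :
    Var[S X n; μ] = tailVar μ (truncSeq X n) n 0 := by
  have hmean : ∫ ω, S X n ω ∂μ = 0 := by
    unfold S
    rw [integral_finsetSum _ fun i hi => integrable_of_memLp_top (hbdd i (mem_Icc.1 hi).1)]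
    exact sum_eq_zero fun i hi => hcent i (mem_Icc.1 hi).1
  rw [variance_of_integral_eq_zero (measurable_partialSum_of_measurable hmeas n).aemeasurable
    hmean, tailVar]
  simp_rw [← range_eq_Ico, sum_range_truncSeq]

/-- Quantitative central limit theorem in terms of the smoothing level `K = max ‖X i‖_∞`. -/
lemma W₁_le_of_maxSupNorm_pos : ∃ a : ℝ, 0 < a ∧ ∀ (hmeas : ∀ i, 1 ≤ i → Measurable (X i))
    (_ : ∀ i, 1 ≤ i → MemLp (X i) ∞ μ) (_ : ∀ i, 1 ≤ i → ∫ ω, X i ω ∂μ = 0)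
    (_ : ∑' k : ℕ, (k : ℝ≥0∞) * rho X μ k < ∞) (R : ℝ)
    (_ : R = (∑' k : ℕ, (k : ℝ≥0∞) * rho X μ k).toReal) (n : ℕ) (_ : varRatio X μ n < ∞)
    (K c V : ℝ) (_ : K = (maxSupNorm X μ n).toReal) (_ : 0 < K)
    (_ : c = (varRatio X μ n).toReal) (_ : V = Var[S X n; μ]),
    W₁ (μ.map (S X n)) (gaussianReal 0 V.toNNReal) ≤
      ENNReal.ofReal (a * K * (1 + (2 + 2 * R) ^ 2 + 14 * (2 + 2 * R) * R) *
        (1 + c * Real.log (1 + c * V / K ^ 2))) := by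
  obtain ⟨cφ, hcφ, hheat⟩ := exists_heatExpansion
  set e : ℝ := ∫ z, |z| ∂(gaussianReal 0 1) with he
  have he0 : 0 ≤ e := integral_nonneg fun _ => abs_nonneg _
  refine ⟨2 * e + 2 * cφ, by positivity, ?_⟩
  intro hmeas hbdd hcent hH1 R hR n hfin K c V hK hKpos hc hV
  have hSm := measurable_partialSum_of_measurable hmeas n
  have : IsProbabilityMeasure (μ.map (S X n)) := Measure.isProbabilityMeasure_map hSm.aemeasurable
  have h : CorrelationDecay μ (truncSeq X n) (pastFiltration X hmeas) (rhoReal X μ) K R := by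
    rw [hK, hR]
    exact correlationDecay_truncSeq hmeas hbdd hcent hH1 n (hK ▸ hKpos)
  have hR0 : 0 ≤ R := h.R_nonneg
  set x : ℕ → ℝ := fun i => ∫ ω, truncSeq X n i ω ^ 2 ∂μ with hx
  have hx0 : ∀ i, 0 ≤ x i := fun i => integral_nonneg fun _ => sq_nonneg _
  have hxK : ∀ i, x i ≤ K ^ 2 := fun i => by
    rw [hx]
    simp only
    rw [← l2_sq]
    exact pow_le_pow_left₀ (l2_nonneg _) (h.l2_le i) 2
  have hratio : ∀ l, l < n → ∑ i ∈ Ico l n, x i ≤ c * tailVar μ (truncSeq X n) n l :=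
    fun l hl => by
      rw [hc]
      exact sum_sq_le_varRatio_mul hl hfin
  have hc1 : 1 ≤ c := h.one_le_of_sum_sq_le hratio (exists_pos_of_maxSupNorm_pos hmeas hbdd
    (hK ▸ hKpos))
  have hc0 : 0 < c := by linarith
  have hVt : V = tailVar μ (truncSeq X n) n 0 := hV.trans (variance_eq_tailVar hmeas hbdd hcent n)
  have hV0 : 0 ≤ V := hVt ▸ tailVar_nonneg (μ := μ) n 0
  have hn : 0 < n := by
    rcases Nat.eq_zero_or_pos n with rfl | hn
    · simp [maxSupNorm] at hK
      linarith
    · exact hn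
  -- The sum starts at l + 1 so that w l lies below both t l and t (l + 1). Using second moments
  -- instead of tail variances makes w antitone.
  set w : ℕ → ℝ := fun l => K ^ 2 + (∑ i ∈ Ico (l + 1) n, x i) / c with hw
  have hT : ∀ l, 0 ≤ ∑ i ∈ Ico l n, x i := fun l => sum_nonneg fun i _ => hx0 i
  have hwa : Antitone w := antitone_nat_of_succ_le fun l => by
    simp only [hw]
    gcongr
    exact Nat.le_succ _
  have hwK : ∀ l, K ^ 2 ≤ w l := fun l => le_add_of_nonneg_right (div_nonneg (hT _) hc0.le)
  have hw1 : ∀ l, l < n → w l ≤ K ^ 2 + tailVar μ (truncSeq X n) n (l + 1) := by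
    intro l hl
    simp only [hw]
    gcongr
    rw [div_le_iff₀' hc0]
    rcases Nat.lt_or_ge (l + 1) n with hl1 | hl1
    · exact hratio _ hl1
    · rw [Ico_eq_empty_of_le hl1, sum_empty]
      exact mul_nonneg hc0.le (tailVar_nonneg _ _)
  have hw0 : ∀ l, l < n → w l ≤ K ^ 2 + tailVar μ (truncSeq X n) n l := by
    intro l hl
    simp only [hw]
    gcongr
    rw [div_le_iff₀' hc0]
    exact (sum_le_sum_of_subset_of_nonneg (Ico_subset_Ico_left (Nat.le_succ l))
      fun i _ _ => hx0 i).trans (hratio l hl)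
  have hsum : ∑ l ∈ range n, x l / w l ≤ 2 * c * Real.log (1 + c * V / K ^ 2) := by
    refine (sum_div_tail_le_log hx0 (by positivity) hxK hc1 n).trans ?_
    have hT0 : ∑ i ∈ range n, x i ≤ c * V := by
      rw [range_eq_Ico, hVt]
      exact hratio 0 hn
    have : 0 ≤ ∑ i ∈ range n, x i := sum_nonneg fun i _ => hx0 i
    gcongr
  have hL0 : 0 ≤ Real.log (1 + c * V / K ^ 2) := Real.log_nonneg (by
    have : 0 ≤ c * V / K ^ 2 := by positivity
    linarith)
  refine W₁_le_of_smooth_dual _ _ ?_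
  rintro f s hs hsc hs1 hf ⟨M, hM⟩
  obtain ⟨φ₁, φ₂, hφ⟩ := hheat f s hs hsc hs1 hf ⟨M, hM⟩
  have hlip : LipschitzWith 1 f := lipschitzWith_of_nnnorm_deriv_le
    (fun x => (hf x).differentiableAt) fun x => by
      rw [(hf x).deriv, ← NNReal.coe_le_coe]
      simpa using hs1 x
  have hmain := h.abs_integral_sub_le hcφ.le hφ hwa hwK hw0 hw1
  simp_rw [sum_range_truncSeq] at hmain
  rw [← hVt] at hmain
  rw [integral_map hSm.aemeasurable hlip.continuous.aestronglyMeasurable,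
    integral_gaussianReal_eq_heat f hlip.continuous hV0]
  -- Both ends are smoothed by a Gaussian of variance K², at a cost of K E|N| each.
  have hsmooth1 : |∫ ω, f (S X n ω) ∂μ - ∫ ω, heat f (K ^ 2) (S X n ω) ∂μ| ≤ K * e := by
    have i1 : Integrable (fun ω => f (S X n ω)) μ :=
      Integrable.of_bound (hlip.continuous.measurable.comp hSm).aestronglyMeasurable M
        (ae_of_all _ fun ω => hM _)
    have i2 : Integrable (fun ω => heat f (K ^ 2) (S X n ω)) μ :=
      Integrable.of_bound ((hφ.cont (K ^ 2)).1.measurable.comp hSm).aestronglyMeasurable M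
        (ae_of_all _ fun ω => abs_heat_le hM _ _)
    rw [← integral_sub i1 i2]
    have := norm_integral_le_of_norm_le_const (μ := μ) (C := K * e)
      (f := fun ω => f (S X n ω) - heat f (K ^ 2) (S X n ω)) (ae_of_all _ fun ω => by
        have := abs_heat_sub_heat_le hlip hM (K ^ 2) 0 (S X n ω)
        rwa [heat_zero, Real.sqrt_zero, Real.sqrt_sq hKpos.le, zero_sub, abs_neg,
          abs_of_pos hKpos] at this)
    simpa using this
  have hsmooth2 : |heat f (K ^ 2 + V) 0 - heat f V 0| ≤ K * e := by
    refine (abs_heat_sub_heat_le hlip hM V (K ^ 2 + V) 0).trans ?_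
    gcongr
    rw [abs_of_nonneg (sub_nonneg.2 (Real.sqrt_le_sqrt (by nlinarith)))]
    have hle : √(K ^ 2 + V) ≤ K + √V := by
      refine Real.sqrt_le_iff.2 ⟨by positivity, ?_⟩
      nlinarith [Real.sq_sqrt hV0, mul_nonneg hKpos.le (Real.sqrt_nonneg V)]
    linarith
  set L := Real.log (1 + c * V / K ^ 2) with hL
  set A := (2 + 2 * R) ^ 2 + 14 * (2 + 2 * R) * R with hA
  have hA0 : 0 ≤ A := by positivity
  have hmain' : |∫ ω, heat f (K ^ 2) (S X n ω) ∂μ - heat f (K ^ 2 + V) 0| ≤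
      cφ * K * A * (2 * c * L) := by
    refine hmain.trans ?_
    gcongr
  have b1 := (abs_le.1 hsmooth1).2
  have b2 := (abs_le.1 hsmooth2).2
  have b3 := (abs_le.1 hmain').2
  have hcL : 0 ≤ c * L := by positivity
  calc _ ≤ 2 * e * K + 2 * cφ * K * A * (c * L) := by linarith
    _ ≤ (2 * e + 2 * cφ) * K * (1 + A) * (1 + c * L) := by
        have p1 : 0 ≤ 2 * e * K * (A + (1 + A) * (c * L)) := by positivity
        have p2 : 0 ≤ 2 * cφ * K * (1 + A + c * L) := by positivity
        nlinarith [p1, p2]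
    _ = _ := by rw [hA, add_assoc]

end MainEstimate

end RhoMixingCLT

/-! ### Conclusion: removing K_n² from the logarithm. -/

theorem corollary4p3 {Ω : Type*} [MeasurableSpace Ω] (μ : Measure Ω) [IsProbabilityMeasure μ]
    (X : ℕ → Ω → ℝ)
    (hmeas : ∀ i, 1 ≤ i → Measurable (X i))
    (hbdd : ∀ i, 1 ≤ i → MemLp (X i) ∞ μ)
    (hcent : ∀ i, 1 ≤ i → ∫ ω, X i ω ∂μ = 0)
    (hmix : Tendsto (RhoMixingCLT.rho X μ) atTop (𝓝 0))
    (hH1 : ∑' k : ℕ, (k : ℝ≥0∞) * RhoMixingCLT.rho X μ k < ∞)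
    (hH2 : ∀ n, 1 ≤ n → RhoMixingCLT.varRatio X μ n < ∞) :
    ∃ C : ℝ, 0 < C ∧ ∀ n : ℕ, 1 ≤ n →
      RhoMixingCLT.W₁ (μ.map (RhoMixingCLT.S X n))
          (gaussianReal 0 (Var[RhoMixingCLT.S X n; μ]).toNNReal) ≤
        ENNReal.ofReal (C * ((RhoMixingCLT.maxSupNorm X μ n).toReal *
          (1 + (RhoMixingCLT.varRatio X μ n).toReal *
            Real.log (1 + (RhoMixingCLT.varRatio X μ n).toReal *
              Var[RhoMixingCLT.S X n; μ])))) := by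
  open RhoMixingCLT in
  obtain ⟨a, ha, hest⟩ := W₁_le_of_maxSupNorm_pos (μ := μ) (X := X)
  obtain ⟨κ, hκ, hκle⟩ := exists_pos_le_maxSupNorm hbdd
  set R := (∑' k : ℕ, (k : ℝ≥0∞) * rho X μ k).toReal with hR
  have hR0 : 0 ≤ R := ENNReal.toReal_nonneg
  set A := 1 + (2 + 2 * R) ^ 2 + 14 * (2 + 2 * R) * R with hA
  have hA0 : 0 < A := by positivity
  have hlam : 1 ≤ 1 + 1 / κ ^ 2 := le_add_of_nonneg_right (by positivity)
  refine ⟨a * A * (1 + 1 / κ ^ 2), by positivity, fun n hn => ?_⟩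
  obtain ⟨K, hK⟩ : ∃ K, K = (maxSupNorm X μ n).toReal := ⟨_, rfl⟩
  obtain ⟨c, hc⟩ : ∃ c, c = (varRatio X μ n).toReal := ⟨_, rfl⟩
  obtain ⟨V, hV⟩ : ∃ V, V = Var[S X n; μ] := ⟨_, rfl⟩
  have hSm := measurable_partialSum_of_measurable hmeas n
  have : IsProbabilityMeasure (μ.map (S X n)) := Measure.isProbabilityMeasure_map hSm.aemeasurable
  have hK0 : 0 ≤ K := hK ▸ ENNReal.toReal_nonneg
  have hc0 : 0 ≤ c := hc ▸ ENNReal.toReal_nonneg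
  have hV0 : 0 ≤ V := hV ▸ variance_nonneg _ _
  rw [← hK, ← hc, ← hV]
  -- If K_n = 0 then S_n = 0 almost surely, and both laws are the point mass at 0.
  rcases hK0.eq_or_lt with hKz | hKpos
  · have hS := ae_eq_zero_of_maxSupNorm_eq_zero hbdd (hK ▸ hKz.symm)
    have hVz : V = 0 := by rw [hV, variance_congr hS, variance_zero]
    have hlaw : μ.map (S X n) = gaussianReal 0 V.toNNReal := by
      rw [Measure.map_congr hS, hVz, Real.toNNReal_zero, gaussianReal_zero_var]
      simp [Pi.zero_def]
    rw [hlaw, ← hKz]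
    refine W₁_le_of_smooth_dual _ _ fun f s _ _ _ _ _ => ?_
    simp
  · refine (hest hmeas hbdd hcent hH1 R hR n (hH2 n hn) K c V hK hKpos hc hV).trans ?_
    refine ENNReal.ofReal_le_ofReal ?_
    have hκK : κ ≤ K := hK ▸ hκle n (hK ▸ hKpos)
    -- Here the constant comes to depend on the law of the sequence, through κ. The factor 1 + 1/κ²,
    -- rather than 1/κ², is at least 1, as `log_one_add_mul_le` requires.
    have hlog : Real.log (1 + c * V / K ^ 2) ≤ (1 + 1 / κ ^ 2) * Real.log (1 + c * V) := by
      refine le_trans (Real.log_le_log (by positivity) ?_)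
        (log_one_add_mul_le hlam (mul_nonneg hc0 hV0))
      gcongr
      calc c * V / K ^ 2 ≤ c * V / κ ^ 2 := by gcongr
        _ = 1 / κ ^ 2 * (c * V) := by ring
        _ ≤ (1 + 1 / κ ^ 2) * (c * V) := by
          gcongr
          linarith
    calc a * K * A * (1 + c * Real.log (1 + c * V / K ^ 2))
        ≤ a * K * A * ((1 + 1 / κ ^ 2) + c * ((1 + 1 / κ ^ 2) * Real.log (1 + c * V))) := by
          gcongr
      _ = _ := by ring
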